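/- **Theorem 1.1.** For a surface $\Sigma$ in $\mathbb R^3$ with unit normal $\nu=(\nu_1,\nu_2,\nu_3)$ and mean curvature $H$ (half the trace of $h(v,w)=-\langle d\nu(v),w\rangle$), the anisotropic mean curvature of the Dirichlet energy $\int_\Sigma F(\nu)\,d\Sigma$, $F(\nu)=\frac1{\nu_3}-\nu_3$, is defined at the points where $\nu_3\neq0$ as $\Lambda=2HF(\nu)-\operatorname{div}_\Sigma DF$, where $DF$ is the gradient of $F$ on the unit sphere $\mathbb S^2$. (It does not depend on the choice of $\pm\nu$.) Let $I\subset\mathbb R$ be an open interval, $\beta\colon I\to\mathbb S^2$ a smooth curve with $|\beta'|=1$, let $a,b\colon I\to\mathbb R$ be smooth functions and $$X(s,t)=\alpha(s)+t\beta(s),\qquad \alpha=a\,\beta'+b\,\beta\times\beta',\qquad (s,t)\in I\times\mathbb R,$$ a non-cylindrical ruled surface $\Sigma$, with unit normal $\nu=X_s\times X_t/|X_s\times X_t|$ where $X_s\times X_t\ne0$. Assume that $\nu_3$ does not vanish identically and that the anisotropic mean curvature is a constant $\Lambda\in\mathbb R$ at all points $(s,t)$ where $X$ is regular and $\nu_3\ne0$.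 Then $\beta$ is (an arc of) a great circle of $\mathbb S^2$. Moreover, up to a rotation about the $z$-axis, a translation of $\mathbb R^3$, and a change of parameters $s\mapsto\pm s+s_0$, $t\mapsto t+\tau(s)$, the surface $\Sigma$ is one of the following, with $s$ in an interval. 1. Case $\Lambda=0$. - (a) (A part of) a plane. - (b) A helicoid: $\beta(s)=(\cos s,\sin s,0)$ is the horizontal equator and $$a(s)=c_1\cos s,\quad b(s)=b_1 s,\qquad c_1\ne0,\ b_1\neq0.$$ - (c) $\beta(s)=(\cos s,0,\sin s)$ is the vertical equator, $s$ ranges in a subinterval of $(-\frac\pi2,\frac\pi2)$, and $$a(s)=c_1\cos(s+c_2),\quad b(s)=b_1\tan s,\qquad c_1,c_2\in\mathbb R,\ c_1\ne0,\ b_1\ne0.$$ - (d) $\beta(s)=(\cos s,\sqrt{1-m^2}\sin s,m\sin s)$ is a non-horizontal, non-vertical great circle and $$\begin{aligned}a(s)&=c_1\cos s+c_2\sin s-\frac{b_1m}{1-m^2}\cos s\,\cot^{-1}\!\big(\sqrt{1-m^2}\tan s\big)+\frac{b_1}{m\sqrt{1-m^2}}\sin s,\\ b(s)&=\frac{b_1}{\sqrt{1-m^2}}\tan^{-1}\!\big(\sqrt{1-m^2}\tan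 s\big),\end{aligned}$$ with $c_1,c_2,b_1,m\in\mathbb R$, $b_1\neq0$, $m\in(0,1)$. Here $\tan^{-1}(\sqrt{1-m^2}\tan s)$ is the continuous branch on $\mathbb R$ that vanishes at $s=0$, and $\cot^{-1}=\frac\pi2-\tan^{-1}$. 2. Case $\Lambda\neq0$. Then $\beta(s)=(\cos s,0,\sin s)$ is the vertical equator, $s$ ranges in a subinterval of $(-\frac\pi2,\frac\pi2)$, and $$a(s)=c_1\cos s+c_2\sin s-\frac{\Lambda b_1^2\cos(2s)}{4\cos s},\quad b(s)=b_1\tan s,\qquad c_1,c_2\in\mathbb R,\ b_1\ne0.$$ -/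

import Mathlib

open scoped ContDiff

noncomputable section

namespace RuledDirichlet

/-- Euclidean space `ℝ³`; the coordinates are `x 0`, `x 1`, `x 2`, the last one being the vertical
coordinate `z`. -/
abbrev E3 : Type := EuclideanSpace ℝ (Fin 3)

/-- The vector product of `ℝ³`. -/
def cross (x y : E3) : E3 := WithLp.toLp 2 (crossProduct x.ofLp y.ofLp)

section Surfaces

/-- Partial derivative in the first parameter. -/
def dS (V : ℝ → ℝ → E3) (s t : ℝ) : E3 := deriv (fun s' => V s' t) s

/-- Partial derivative in the second parameter. -/
def dT (V : ℝ → ℝ → E3) (s t : ℝ) : E3 := deriv (fun t' => V s t') t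

/-- The unit normal `X_s × X_t / |X_s × X_t|` (it is `0` where `X` is not an immersion). -/
def unitNormal (X : ℝ → ℝ → E3) (s t : ℝ) : E3 :=
  ‖cross (dS X s t) (dT X s t)‖⁻¹ • cross (dS X s t) (dT X s t)

/-- The divergence along the surface `X` of an `ℝ³`-valued field `V` on it:
`∑ g^{ij} ⟨∂ᵢ V, ∂ⱼ X⟩`, where `g` is the first fundamental form of `X`. -/
def surfDiv (X V : ℝ → ℝ → E3) (s t : ℝ) : ℝ :=
  (inner ℝ (dT X s t) (dT X s t) * inner ℝ (dS V s t) (dS X s t)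
    - inner ℝ (dS X s t) (dT X s t)
        * (inner ℝ (dS V s t) (dT X s t) + inner ℝ (dT V s t) (dS X s t))
    + inner ℝ (dS X s t) (dS X s t) * inner ℝ (dT V s t) (dT X s t))
  / (inner ℝ (dS X s t) (dS X s t) * inner ℝ (dT X s t) (dT X s t)
      - inner ℝ (dS X s t) (dT X s t) ^ 2)

/-- The mean curvature: half of the trace of the second fundamental form
`h(v, w) = -⟨dν(v), w⟩` with respect to the first one. -/
def meanCurvature (X : ℝ → ℝ → E3) (s t : ℝ) : ℝ :=
  -(1 / 2) * surfDiv X (unitNormal X) s t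

/-- The gradient on the unit sphere, at the unit vector `n`, of a function `F` on (an open part of)
the sphere: it is the gradient in `ℝ³` of the extension of `F` that is constant along rays. -/
def sphereGradient (F : E3 → ℝ) (n : E3) : E3 :=
  gradient (fun x : E3 => F (‖x‖⁻¹ • x)) n

/-- The anisotropic mean curvature `2 H F(ν) - div_Σ (DF(ν))` of the surface `X` for the energy
`∫ F(ν) dΣ`. -/
def anisotropicMeanCurvature (F : E3 → ℝ) (X : ℝ → ℝ → E3) (s t : ℝ) : ℝ :=
  2 * meanCurvature X s t * F (unitNormal X s t)
    - surfDiv X (fun s' t' => sphereGradient F (unitNormal X s' t')) s t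

/-- The integrand `1/ν₃ - ν₃` of the Dirichlet energy. -/
def dirichletDensity (n : E3) : ℝ := 1 / n 2 - n 2

end Surfaces

section Ruled

/-- The ruled surface `X(s,t) = α(s) + t β(s)`. -/
def ruled (α β : ℝ → E3) (s t : ℝ) : E3 := α s + t • β s

/-- The directrix `a β' + b β × β'`. -/
def directrix (β : ℝ → E3) (a b : ℝ → ℝ) (s : ℝ) : E3 :=
  a s • deriv β s + b s • cross (β s) (deriv β s)

/-- On `I`, the curve `β` runs in a great circle of the unit sphere. -/
def InGreatCircle (I : Set ℝ) (β : ℝ → E3) : Prop :=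
  ∃ w : E3, ‖w‖ = 1 ∧ ∀ s ∈ I, ‖β s‖ = 1 ∧ inner ℝ w (β s) = 0

/-- The surface `X(I × ℝ)` is (part of) a plane. -/
def IsPlanar (I : Set ℝ) (X : ℝ → ℝ → E3) : Prop :=
  ∃ (n : E3) (d : ℝ), n ≠ 0 ∧ ∀ s ∈ I, ∀ t : ℝ, inner ℝ n (X s t) = d

/-- Rotation by the angle `θ` about the `z`-axis. -/
def rotZ (θ : ℝ) (x : E3) : E3 :=
  !₂[Real.cos θ * x 0 - Real.sin θ * x 1, Real.sin θ * x 0 + Real.cos θ * x 1, x 2]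

/-- After a rotation about the `z`-axis and a translation, the ruled surface `α + t β`, `s ∈ I`,
is the ruled surface with rulings `βm` and directrix `am βm' + bm βm × βm'` over the
interval `J`. The parameter `s` is allowed to change by a translation, possibly with a change of
orientation, and `t` by a translation along each ruling (a translation of `ℝ³` does not preserve
the normalization `⟨α, β⟩ = 0` of the directrix). -/
def SameUpToMotion (I : Set ℝ) (α β : ℝ → E3)
    (J : Set ℝ) (βm : ℝ → E3) (am bm : ℝ → ℝ) : Prop :=
  ∃ (θ : ℝ) (v : E3) (σ s₀ : ℝ) (τ : ℝ → ℝ),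
    (σ = 1 ∨ σ = -1) ∧
    (fun s => σ * s + s₀) '' I = J ∧
    (∀ s ∈ I, rotZ θ (β s) = βm (σ * s + s₀)) ∧
    ∀ s ∈ I, ∀ t : ℝ,
      rotZ θ (ruled α β s t) + v = ruled (directrix βm am bm) βm (σ * s + s₀) (t + τ s)

/-- The horizontal equator. -/
def horizontalEquator (s : ℝ) : E3 := !₂[Real.cos s, Real.sin s, 0]

/-- The vertical equator in the `xz`-plane. -/
def verticalEquator (s : ℝ) : E3 := !₂[Real.cos s, 0, Real.sin s]

/-- The great circle in the plane `√(1 - m²) z = m y`. -/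
def obliqueCircle (m s : ℝ) : E3 :=
  !₂[Real.cos s, Real.sqrt (1 - m ^ 2) * Real.sin s, m * Real.sin s]

/-- The continuous branch on `ℝ` of `arctan (k tan s)`, `k > 0`, that vanishes at `s = 0`
(see the three lemmas below, which determine it). -/
def arctanBranch (k s : ℝ) : ℝ :=
  s + Real.arctan ((k - 1) * Real.sin s * Real.cos s
        / (Real.cos s ^ 2 + k * Real.sin s ^ 2))

theorem arctanBranch_eq {k s : ℝ} (hk : 0 < k) (hs : s ∈ Set.Ioo (-(Real.pi / 2)) (Real.pi / 2)) :
    arctanBranch k s = Real.arctan (k * Real.tan s) := by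
  have hc : 0 < Real.cos s := Real.cos_pos_of_mem_Ioo hs
  have h1 : (k * Real.tan s) * (-Real.tan s) < 1 := by nlinarith [mul_nonneg hk.le (sq_nonneg (Real.tan s))]
  have h2 := Real.arctan_add h1
  rw [Real.arctan_neg, Real.arctan_tan hs.1 hs.2] at h2
  have h3 : (k - 1) * Real.sin s * Real.cos s / (Real.cos s ^ 2 + k * Real.sin s ^ 2)
      = (k * Real.tan s + -Real.tan s) / (1 - k * Real.tan s * -Real.tan s) := by
    rw [Real.tan_eq_sin_div_cos]
    have : 0 < Real.cos s ^ 2 + k * Real.sin s ^ 2 := by positivity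
    have h4 : 1 - k * (Real.sin s / Real.cos s) * -(Real.sin s / Real.cos s)
        = (Real.cos s ^ 2 + k * Real.sin s ^ 2) / Real.cos s ^ 2 := by
      field_simp
      ring
    rw [h4]
    field_simp
    ring
  rw [arctanBranch, h3, ← h2]
  ring

theorem arctanBranch_add_pi (k s : ℝ) :
    arctanBranch k (s + Real.pi) = arctanBranch k s + Real.pi := by
  simp only [arctanBranch, Real.sin_add_pi, Real.cos_add_pi, neg_sq, mul_neg, neg_mul, neg_neg]
  ring

theorem continuous_arctanBranch {k : ℝ} (hk : 0 < k) : Continuous (arctanBranch k) := by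
  have h : ∀ s : ℝ, Real.cos s ^ 2 + k * Real.sin s ^ 2 ≠ 0 := by
    intro s hs
    have h1 := Real.sin_sq_add_cos_sq s
    have h2 : Real.cos s ^ 2 = 0 := by
      nlinarith [sq_nonneg (Real.cos s), mul_nonneg hk.le (sq_nonneg (Real.sin s))]
    have h3 : Real.sin s ^ 2 = 1 := by linarith
    rw [h2, h3] at hs
    linarith
  unfold arctanBranch
  exact continuous_id.add (Real.continuous_arctan.comp
    (Continuous.div (by fun_prop) (by fun_prop) h))

/-- `b(s) = b₁ / √(1 - m²) · tan⁻¹(√(1 - m²) tan s)`. -/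
def obliqueB (b₁ m s : ℝ) : ℝ :=
  b₁ / Real.sqrt (1 - m ^ 2) * arctanBranch (Real.sqrt (1 - m ^ 2)) s

/-- `a(s) = c₁ cos s + c₂ sin s - b₁ m / (1 - m²) · cos s · cot⁻¹(√(1 - m²) tan s)
  + b₁ / (m √(1 - m²)) · sin s`, where `cot⁻¹ = π/2 - tan⁻¹`. -/
def obliqueA (c₁ c₂ b₁ m s : ℝ) : ℝ :=
  c₁ * Real.cos s + c₂ * Real.sin s
    - b₁ * m / (1 - m ^ 2) * Real.cos s
        * (Real.pi / 2 - arctanBranch (Real.sqrt (1 - m ^ 2)) s)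
    + b₁ / (m * Real.sqrt (1 - m ^ 2)) * Real.sin s

end Ruled

end RuledDirichlet

end

open RuledDirichlet

/-!
A surface that is a graph `z = u(x, y)` has Dirichlet energy `∫ |∇u|²` and anisotropic mean
curvature `2 Δu`, so the theorem classifies the ruled graphs with constant Laplacian.  No graph representation
is needed, though: with `N = X_s × X_t`, the multiples of `N` in `2 H F(ν) ν` and in `DF(ν)`
combine, and `Λ = -div_Σ (2 N / N₃ - (|N|² / N₃²) e₃)`, which is `anisotropicMeanCurvature_mul`.

In the frame `β, β', γ = β × β'`, with `β'' = -β + k γ`, one has `N = Q β' - T γ` for the pitch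
`Q = b' + a k` and `T = t + a' - b k`, and the curvature equation becomes an identity between a
quadratic polynomial in `T` and `Λ (Q β'₃ - T γ₃)³` (`anisotropicMeanCurvature_ruled`).  Comparing
coefficients on a ruling with `(γ₃, Q β'₃) ≠ 0` gives `Λ γ₃ = 0`, `k = 0`, a first order equation
saying that the flux `q = Q (1 - β₃²)` has derivative zero, and a second order equation for `a`
(`IsDirichletRuled.equations`).  The pair `(γ₃, q)` vanishes exactly on the remaining rulings and
has derivative zero on the others, so `γ₃² + q²` is constant; as it is nonzero somewhere, there are no
remaining rulings (`IsDirichletRuled.nondegenerate`).  Hence `k = 0` everywhere, `γ` is constant and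
`β` runs in a great circle.

If `q = 0`, then `b` is constant and the surface lies in a plane with normal `γ`.  Otherwise a
rotation about the `z`-axis brings `β` into the form `(cos u, g sin u, m sin u)` with `u = ± s + s₀`
(`IsDirichletRuled.exists_greatCircle`), and `b'` and `a'' + a` are explicit functions of `u`
(`IsDirichletRuled.ode_greatCircle`).  These determine the surface up to a translation, since for
`d'' + d = 0` the vector `d β' - d' β` is constant (`IsDirichletRuled.sameUpToMotion`).  It remains
to check the two equations for the listed functions; the solutions `c₁ cos s + c₂ sin s` of the
homogeneous equation are absorbed by the translation, so that their coefficients may be prescribed.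
-/

noncomputable section

namespace RuledDirichlet

/-! ### Vector algebra and calculus in `ℝ³` -/

theorem inner_eq_sum (x y : E3) : inner ℝ x y = x 0 * y 0 + x 1 * y 1 + x 2 * y 2 := by
  simp only [PiLp.inner_apply, Fin.sum_univ_three, RCLike.inner_apply, conj_trivial]
  ring

theorem cross_zero (x y : E3) : cross x y 0 = x 1 * y 2 - x 2 * y 1 := by
  simp [cross, cross_apply]

theorem cross_one (x y : E3) : cross x y 1 = x 2 * y 0 - x 0 * y 2 := by
  simp [cross, cross_apply]

theorem cross_two (x y : E3) : cross x y 2 = x 0 * y 1 - x 1 * y 0 := by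
  simp [cross, cross_apply]

theorem ext_coord {x y : E3} (h0 : x 0 = y 0) (h1 : x 1 = y 1) (h2 : x 2 = y 2) : x = y := by
  ext i
  fin_cases i <;> assumption

theorem hasDerivAt_coord_iff {f : ℝ → E3} {f' : E3} {x : ℝ} :
    HasDerivAt f f' x ↔ ∀ i, HasDerivAt (fun s => f s i) (f' i) x := by
  rw [← hasDerivWithinAt_univ, hasDerivWithinAt_iff_hasFDerivWithinAt, hasFDerivWithinAt_euclidean]
  refine forall_congr' fun i => ?_
  rw [← hasDerivWithinAt_univ, hasDerivWithinAt_iff_hasFDerivWithinAt]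
  refine iff_of_eq (congrArg (fun L => HasFDerivWithinAt (fun s => f s i) L Set.univ x) ?_)
  ext
  simp

theorem hasDerivAt_of_coord {f : ℝ → E3} {f' : E3} {x : ℝ}
    (h0 : HasDerivAt (fun s => f s 0) (f' 0) x) (h1 : HasDerivAt (fun s => f s 1) (f' 1) x)
    (h2 : HasDerivAt (fun s => f s 2) (f' 2) x) : HasDerivAt f f' x := by
  refine hasDerivAt_coord_iff.2 fun i => ?_
  fin_cases i <;> assumption

theorem hasDerivAt_cross {f g : ℝ → E3} {f' g' : E3} {x : ℝ}
    (hf : HasDerivAt f f' x) (hg : HasDerivAt g g' x) :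
    HasDerivAt (fun s => cross (f s) (g s)) (cross f' (g x) + cross (f x) g') x := by
  have hf' := hasDerivAt_coord_iff.1 hf
  have hg' := hasDerivAt_coord_iff.1 hg
  refine hasDerivAt_of_coord ?_ ?_ ?_
  · simp only [cross_zero, PiLp.add_apply]
    convert! ((hf' 1).mul (hg' 2)).sub ((hf' 2).mul (hg' 1)) using 1
    ring
  · simp only [cross_one, PiLp.add_apply]
    convert! ((hf' 2).mul (hg' 0)).sub ((hf' 0).mul (hg' 2)) using 1
    ring
  · simp only [cross_two, PiLp.add_apply]
    convert! ((hf' 0).mul (hg' 1)).sub ((hf' 1).mul (hg' 0)) using 1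
    ring

theorem contDiffOn_cross {n : WithTop ℕ∞} {f g : ℝ → E3} {I : Set ℝ}
    (hf : ContDiffOn ℝ n f I) (hg : ContDiffOn ℝ n g I) :
    ContDiffOn ℝ n (fun s => cross (f s) (g s)) I := by
  have hf' := contDiffOn_euclidean.1 hf
  have hg' := contDiffOn_euclidean.1 hg
  refine contDiffOn_euclidean.2 fun i => ?_
  fin_cases i
  · simpa [cross_zero] using ((hf' 1).mul (hg' 2)).sub ((hf' 2).mul (hg' 1))
  · simpa [cross_one] using ((hf' 2).mul (hg' 0)).sub ((hf' 0).mul (hg' 2))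
  · simpa [cross_two] using ((hf' 0).mul (hg' 1)).sub ((hf' 1).mul (hg' 0))

theorem cross_add_left (x y z : E3) : cross (x + y) z = cross x z + cross y z := by
  apply ext_coord <;> simp only [cross_zero, cross_one, cross_two, PiLp.add_apply] <;> ring

theorem cross_add_right (x y z : E3) : cross x (y + z) = cross x y + cross x z := by
  apply ext_coord <;> simp only [cross_zero, cross_one, cross_two, PiLp.add_apply] <;> ring

theorem cross_smul_left (c : ℝ) (x y : E3) : cross (c • x) y = c • cross x y := by
  apply ext_coord <;>
    simp only [cross_zero, cross_one, cross_two, PiLp.smul_apply, smul_eq_mul] <;> ring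

theorem cross_smul_right (c : ℝ) (x y : E3) : cross x (c • y) = c • cross x y := by
  apply ext_coord <;>
    simp only [cross_zero, cross_one, cross_two, PiLp.smul_apply, smul_eq_mul] <;> ring

theorem cross_self (x : E3) : cross x x = 0 := by
  apply ext_coord <;> simp only [cross_zero, cross_one, cross_two, PiLp.zero_apply] <;> ring

theorem cross_anticomm (x y : E3) : cross x y = -cross y x := by
  apply ext_coord <;> simp only [cross_zero, cross_one, cross_two, PiLp.neg_apply] <;> ring

theorem inner_cross_left (x y : E3) : inner ℝ x (cross x y) = 0 := by
  simp only [inner_eq_sum, cross_zero, cross_one, cross_two]; ring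

theorem inner_cross_right (x y : E3) : inner ℝ y (cross x y) = 0 := by
  simp only [inner_eq_sum, cross_zero, cross_one, cross_two]; ring

theorem cross_cross_left (x y z : E3) :
    cross (cross x y) z = inner ℝ x z • y - inner ℝ y z • x := by
  apply ext_coord <;>
    simp only [cross_zero, cross_one, cross_two, PiLp.smul_apply, PiLp.sub_apply, smul_eq_mul,
      inner_eq_sum] <;> ring

/-- Lagrange's identity. -/
theorem inner_cross_self (x y : E3) : inner ℝ (cross x y) (cross x y)
    = inner ℝ x x * inner ℝ y y - inner ℝ x y ^ 2 := by
  simp only [inner_eq_sum, cross_zero, cross_one, cross_two]; ring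

/-- The vertical unit vector. -/
def e₃ : E3 := EuclideanSpace.single 2 1

theorem inner_e₃ (x : E3) : inner ℝ e₃ x = x 2 := by
  simp [e₃, inner_eq_sum]

/-! ### The anisotropic mean curvature of the Dirichlet energy -/

theorem sphereGradient_dirichletDensity {n : E3} (hn : ‖n‖ = 1) (h : n 2 ≠ 0) :
    sphereGradient dirichletDensity n
      = (1 / n 2 + n 2) • n - (1 / n 2 ^ 2 + 1) • e₃ := by
  refine HasGradientAt.gradient ?_
  rw [hasGradientAt_iff_hasFDerivAt]
  have hN : HasFDerivAt (fun x : E3 => √(‖x‖ ^ 2)) _ n :=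
    ((hasFDerivAt_id n).norm_sq).sqrt (by simp [hn])
  simp only [Real.sqrt_sq (norm_nonneg _), id, hn] at hN
  have h2 : HasFDerivAt (fun x : E3 => x 2) (EuclideanSpace.proj 2 : E3 →L[ℝ] ℝ) n :=
    (EuclideanSpace.proj 2 : E3 →L[ℝ] ℝ).hasFDerivAt
  have hne : ‖n‖ ≠ 0 := by simp [hn]
  have hN' := (hasDerivAt_inv hne).comp_hasFDerivAt n hN
  have h2' := (hasDerivAt_inv h).comp_hasFDerivAt n h2
  have hq := (hN.fun_mul h2').fun_sub (h2.fun_mul hN')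
  refine (hq.congr_fderiv ?_).congr_of_eventuallyEq (Filter.Eventually.of_forall fun x => ?_)
  · ext v
    have : inner ℝ (e₃) v = v 2 := inner_e₃ v
    simp [hn, this]
    field_simp
    ring
  · simp [dirichletDensity, mul_comm]

/-- The numerator `∑ det(g) g^{ij} ⟨Vᵢ, Xⱼ⟩` of the divergence of a field with partial derivatives
`Vs`, `Vt` along a surface with partial derivatives `Xs`, `Xt`. -/
def divNum (Xs Xt Vs Vt : E3) : ℝ :=
  inner ℝ Xt Xt * inner ℝ Vs Xs - inner ℝ Xs Xt * (inner ℝ Vs Xt + inner ℝ Vt Xs)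
    + inner ℝ Xs Xs * inner ℝ Vt Xt

theorem surfDiv_eq_divNum {X V : ℝ → ℝ → E3} {s t : ℝ} {Vs Vt : E3}
    (hs : HasDerivAt (fun s' => V s' t) Vs s) (ht : HasDerivAt (fun t' => V s t') Vt t) :
    surfDiv X V s t = divNum (dS X s t) (dT X s t) Vs Vt
      / inner ℝ (cross (dS X s t) (dT X s t)) (cross (dS X s t) (dT X s t)) := by
  have h1 : dS V s t = Vs := hs.deriv
  have h2 : dT V s t = Vt := ht.deriv
  rw [surfDiv, h1, h2, inner_cross_self, divNum]

theorem divNum_normal (Xs Xt Vs Vt Ws Wt : E3) (c ps pt qs qt : ℝ) :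
    divNum Xs Xt (c • Vs + ps • cross Xs Xt + qs • Ws) (c • Vt + pt • cross Xs Xt + qt • Wt)
      = c * divNum Xs Xt Vs Vt + divNum Xs Xt (qs • Ws) (qt • Wt) := by
  have h1 : inner ℝ (cross Xs Xt) Xs = 0 := by rw [real_inner_comm, inner_cross_left]
  have h2 : inner ℝ (cross Xs Xt) Xt = 0 := by rw [real_inner_comm, inner_cross_right]
  simp only [divNum, inner_add_left, real_inner_smul_left, h1, h2]
  ring

theorem unitNormal_two (X : ℝ → ℝ → E3) (s t : ℝ) : unitNormal X s t 2
    = ‖cross (dS X s t) (dT X s t)‖⁻¹ * cross (dS X s t) (dT X s t) 2 := by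
  simp [unitNormal]

theorem norm_ne_zero_of_two {n : E3} (h : n 2 ≠ 0) : ‖n‖ ≠ 0 := by
  intro h0
  rw [norm_eq_zero] at h0
  simp [h0] at h

theorem hasDerivAt_normalize {N : ℝ → E3} {N' : E3} {x : ℝ} (hN : HasDerivAt N N' x)
    (h3 : N x 2 ≠ 0) :
    ∃ p : ℝ, HasDerivAt (fun y => ‖N y‖⁻¹ • N y) (‖N x‖⁻¹ • N' + p • N x + (0 : ℝ) • e₃) x := by
  have hne := norm_ne_zero_of_two h3
  have hd : DifferentiableAt ℝ (fun y => ‖N y‖⁻¹) x :=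
    (hN.differentiableAt.norm ℝ (norm_ne_zero_iff.1 hne)).inv hne
  refine ⟨deriv (fun y => ‖N y‖⁻¹) x, ?_⟩
  simpa using hd.hasDerivAt.fun_smul hN

/-- Along a curve of normals `N` with nonzero third component, the gradient `DF(N/|N|)` of the
Dirichlet integrand is, up to a constant, `(1/N₃ + N₃/|N|²) N - (|N|²/N₃²) e₃`; the coefficient `p`
of `N` in its derivative plays no role in the divergence. -/
theorem hasDerivAt_sphereGradient {N : ℝ → E3} {N' : E3} {x : ℝ} (hN : HasDerivAt N N' x)
    (h3 : N x 2 ≠ 0) :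
    ∃ p : ℝ, HasDerivAt (fun y => sphereGradient dirichletDensity (‖N y‖⁻¹ • N y))
      ((1 / N x 2 + N x 2 / ‖N x‖ ^ 2) • N' + p • N x
        + (-(2 * inner ℝ (N x) N' * N x 2 - 2 * ‖N x‖ ^ 2 * N' 2) / N x 2 ^ 3) • e₃) x := by
  have hne := norm_ne_zero_of_two h3
  have hc : HasDerivAt (fun y => N y 2) (N' 2) x := hasDerivAt_coord_iff.1 hN 2
  have hφ : DifferentiableAt ℝ (fun y => 1 / N y 2 + N y 2 / ‖N y‖ ^ 2) x :=
    ((differentiableAt_const _).div hc.differentiableAt h3).add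
      (hc.differentiableAt.div (hN.norm_sq.differentiableAt) (pow_ne_zero 2 hne))
  have hψ := ((hN.norm_sq.fun_div (hc.fun_pow 2) (pow_ne_zero 2 h3)).add_const 1).smul_const e₃
  refine ⟨deriv (fun y => 1 / N y 2 + N y 2 / ‖N y‖ ^ 2) x, ?_⟩
  have hmain := (hφ.hasDerivAt.fun_smul hN).fun_sub hψ
  have hev : ∀ᶠ y in nhds x, N y 2 ≠ 0 := hc.continuousAt.eventually_ne h3
  refine (hmain.congr_deriv ?_).congr_of_eventuallyEq ?_
  · rw [sub_eq_add_neg, ← neg_smul]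
    congr 2
    field_simp
    simp
    ring
  · filter_upwards [hev] with y hy
    have hney := norm_ne_zero_of_two hy
    have hu : ‖‖N y‖⁻¹ • N y‖ = 1 := by
      rw [norm_smul, norm_inv, norm_norm, inv_mul_cancel₀ hney]
    have hu2 : (‖N y‖⁻¹ • N y) 2 ≠ 0 := by
      simp only [PiLp.smul_apply, smul_eq_mul]
      exact mul_ne_zero (inv_ne_zero hney) hy
    rw [sphereGradient_dirichletDensity hu hu2, smul_smul]
    simp only [PiLp.smul_apply, smul_eq_mul]
    congr 2
    · field_simp
    · field_simp

/-- The anisotropic mean curvature in terms of the non-normalized normal `N = X_s × X_t`.  The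
multiples of `N` in `2 H F(ν) ν` and `DF(ν)` combine, and only `2 N / N₃ - (|N|² / N₃²) e₃`, the
gradient of the homogeneous extension of `F`, is differentiated. -/
theorem anisotropicMeanCurvature_mul {X N : ℝ → ℝ → E3} {s t : ℝ} {Ns Nt : E3}
    (hNs : ∀ᶠ s' in nhds s, cross (dS X s' t) (dT X s' t) = N s' t)
    (hNt : ∀ᶠ t' in nhds t, cross (dS X s t') (dT X s t') = N s t')
    (hs : HasDerivAt (fun s' => N s' t) Ns s) (ht : HasDerivAt (fun t' => N s t') Nt t)
    (h3 : N s t 2 ≠ 0) :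
    anisotropicMeanCurvature dirichletDensity X s t * inner ℝ (N s t) (N s t) * N s t 2 ^ 3
      = -2 * N s t 2 ^ 2 * divNum (dS X s t) (dT X s t) Ns Nt
        + divNum (dS X s t) (dT X s t)
          ((2 * inner ℝ (N s t) Ns * N s t 2 - 2 * inner ℝ (N s t) (N s t) * Ns 2) • e₃)
          ((2 * inner ℝ (N s t) Nt * N s t 2 - 2 * inner ℝ (N s t) (N s t) * Nt 2) • e₃) := by
  have hN : N s t = cross (dS X s t) (dT X s t) := hNs.self_of_nhds.symm
  have hne := norm_ne_zero_of_two h3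
  obtain ⟨p₁, hp₁⟩ := hasDerivAt_normalize hs h3
  obtain ⟨p₂, hp₂⟩ := hasDerivAt_normalize ht h3
  obtain ⟨p₃, hp₃⟩ := hasDerivAt_sphereGradient hs h3
  obtain ⟨p₄, hp₄⟩ := hasDerivAt_sphereGradient ht h3
  have hν₁ : HasDerivAt (fun s' => unitNormal X s' t) _ s :=
    hp₁.congr_of_eventuallyEq (hNs.mono fun y hy => by simp only [unitNormal, hy])
  have hν₂ : HasDerivAt (fun t' => unitNormal X s t') _ t :=
    hp₂.congr_of_eventuallyEq (hNt.mono fun y hy => by simp only [unitNormal, hy])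
  have hg₁ : HasDerivAt (fun s' => sphereGradient dirichletDensity (unitNormal X s' t)) _ s :=
    hp₃.congr_of_eventuallyEq (hNs.mono fun y hy => by simp only [unitNormal, hy])
  have hg₂ : HasDerivAt (fun t' => sphereGradient dirichletDensity (unitNormal X s t')) _ t :=
    hp₄.congr_of_eventuallyEq (hNt.mono fun y hy => by simp only [unitNormal, hy])
  have hsplit : ∀ c d : ℝ, divNum (dS X s t) (dT X s t) (c • e₃) (d • e₃)
      = c * divNum (dS X s t) (dT X s t) e₃ 0 + d * divNum (dS X s t) (dT X s t) 0 e₃ := by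
    intro c d
    simp only [divNum, real_inner_smul_left, inner_zero_left]
    ring
  rw [anisotropicMeanCurvature, meanCurvature, surfDiv_eq_divNum hν₁ hν₂,
    surfDiv_eq_divNum hg₁ hg₂, unitNormal, dirichletDensity]
  simp only [PiLp.smul_apply, smul_eq_mul]
  simp only [← hN, real_inner_self_eq_norm_sq] at h3 hne ⊢
  have e1 := divNum_normal (dS X s t) (dT X s t) Ns Nt e₃ e₃
  rw [← hN] at e1
  rw [e1, e1]
  simp only [hsplit]
  field_simp
  ring

/-! ### The moving frame of a spherical curve -/

/-- The third vector `β × β'` of the frame along a spherical curve `β`. -/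
def binormal (β : ℝ → E3) (s : ℝ) : E3 := cross (β s) (deriv β s)

/-- The geodesic curvature `⟨β'', β × β'⟩` of a spherical curve of unit speed. -/
def geodCurv (β : ℝ → E3) (s : ℝ) : ℝ := inner ℝ (deriv (deriv β) s) (binormal β s)

/-- Expansion of a vector in the orthonormal basis `x, y, x × y`. -/
theorem eq_frame_expansion {x y : E3} (hx : ‖x‖ = 1) (hy : ‖y‖ = 1) (hxy : inner ℝ x y = 0)
    (z : E3) :
    z = inner ℝ z x • x + inner ℝ z y • y + inner ℝ z (cross x y) • cross x y := by
  have hx' : inner ℝ x x = 1 := by rw [real_inner_self_eq_norm_sq, hx, one_pow]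
  have hy' : inner ℝ y y = 1 := by rw [real_inner_self_eq_norm_sq, hy, one_pow]
  have hn : inner ℝ (cross x y) (cross x y) = 1 := by rw [inner_cross_self, hx', hy', hxy]; norm_num
  have key : inner ℝ (cross x y) (cross x y) • z
      = inner ℝ z (cross x y) • cross x y
        + inner ℝ z y • (inner ℝ x x • y - inner ℝ x y • x)
        - inner ℝ z x • (inner ℝ x y • y - inner ℝ y y • x) := by
    apply ext_coord <;>
      simp only [PiLp.add_apply, PiLp.sub_apply, PiLp.smul_apply, smul_eq_mul, inner_eq_sum,
        cross_zero, cross_one, cross_two] <;> ring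
  rw [hn, hx', hy', hxy] at key
  simp only [one_smul, zero_smul, sub_zero, zero_sub, smul_neg, sub_neg_eq_add] at key
  rw [add_comm, ← add_assoc, add_right_comm] at key
  rw [add_right_comm, add_comm (_ • x)]
  convert key using 1
  abel

/-- A smooth curve of unit speed on the unit sphere, over an open set of parameters. -/
structure IsSphericalCurve (I : Set ℝ) (β : ℝ → E3) : Prop where
  isOpen : IsOpen I
  smooth : ContDiffOn ℝ ∞ β I
  norm_eq : ∀ s ∈ I, ‖β s‖ = 1
  norm_deriv : ∀ s ∈ I, ‖deriv β s‖ = 1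

theorem hasDerivAt_of_contDiffOn {E : Type*} [NormedAddCommGroup E] [NormedSpace ℝ E] {I : Set ℝ}
    (hI : IsOpen I) {f : ℝ → E} (hf : ContDiffOn ℝ ∞ f I) {s : ℝ} (hs : s ∈ I) :
    HasDerivAt f (deriv f s) s :=
  ((hf.differentiableOn (by simp)).differentiableAt (hI.mem_nhds hs)).hasDerivAt

theorem contDiffOn_deriv {E : Type*} [NormedAddCommGroup E] [NormedSpace ℝ E] {I : Set ℝ}
    (hI : IsOpen I) {f : ℝ → E} (hf : ContDiffOn ℝ ∞ f I) : ContDiffOn ℝ ∞ (deriv f) I :=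
  hf.deriv_of_isOpen hI (by simp)

namespace IsSphericalCurve

variable {I : Set ℝ} {β : ℝ → E3}

theorem inner_self (h : IsSphericalCurve I β) {s : ℝ} (hs : s ∈ I) :
    inner ℝ (β s) (β s) = 1 := by
  rw [real_inner_self_eq_norm_sq, h.norm_eq s hs, one_pow]

theorem inner_deriv_self (h : IsSphericalCurve I β) {s : ℝ} (hs : s ∈ I) :
    inner ℝ (deriv β s) (deriv β s) = 1 := by
  rw [real_inner_self_eq_norm_sq, h.norm_deriv s hs, one_pow]

theorem hasDerivAt (h : IsSphericalCurve I β) {s : ℝ} (hs : s ∈ I) :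
    HasDerivAt β (deriv β s) s :=
  hasDerivAt_of_contDiffOn h.isOpen h.smooth hs

theorem hasDerivAt_deriv' (h : IsSphericalCurve I β) {s : ℝ} (hs : s ∈ I) :
    HasDerivAt (deriv β) (deriv (deriv β) s) s :=
  hasDerivAt_of_contDiffOn h.isOpen (contDiffOn_deriv h.isOpen h.smooth) hs

theorem inner_deriv (h : IsSphericalCurve I β) {s : ℝ} (hs : s ∈ I) :
    inner ℝ (β s) (deriv β s) = 0 := by
  have h1 := (h.hasDerivAt hs).inner ℝ (h.hasDerivAt hs)
  have h2 : HasDerivAt (fun s => inner ℝ (β s) (β s)) (0 : ℝ) s :=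
    (hasDerivAt_const s (1 : ℝ)).congr_of_eventuallyEq
      (Filter.eventually_of_mem (h.isOpen.mem_nhds hs) fun x hx => h.inner_self hx)
  have h3 := h1.unique h2
  rw [real_inner_comm (β s) (deriv β s)] at h3
  linarith

theorem inner_deriv_deriv (h : IsSphericalCurve I β) {s : ℝ} (hs : s ∈ I) :
    inner ℝ (deriv (deriv β) s) (deriv β s) = 0 := by
  have h1 := (h.hasDerivAt_deriv' hs).inner ℝ (h.hasDerivAt_deriv' hs)
  have h2 : HasDerivAt (fun s => inner ℝ (deriv β s) (deriv β s)) (0 : ℝ) s :=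
    (hasDerivAt_const s (1 : ℝ)).congr_of_eventuallyEq
      (Filter.eventually_of_mem (h.isOpen.mem_nhds hs) fun x hx => h.inner_deriv_self hx)
  have h3 := h1.unique h2
  rw [real_inner_comm (deriv (deriv β) s) (deriv β s)] at h3
  linarith

theorem inner_self_deriv_deriv (h : IsSphericalCurve I β) {s : ℝ} (hs : s ∈ I) :
    inner ℝ (deriv (deriv β) s) (β s) = -1 := by
  have h1 := (h.hasDerivAt hs).inner ℝ (h.hasDerivAt_deriv' hs)
  have h2 : HasDerivAt (fun s => inner ℝ (β s) (deriv β s)) (0 : ℝ) s :=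
    (hasDerivAt_const s (0 : ℝ)).congr_of_eventuallyEq
      (Filter.eventually_of_mem (h.isOpen.mem_nhds hs) fun x hx => h.inner_deriv hx)
  have h3 := h1.unique h2
  rw [h.inner_deriv_self hs, real_inner_comm] at h3
  linarith

theorem deriv_deriv (h : IsSphericalCurve I β) {s : ℝ} (hs : s ∈ I) :
    deriv (deriv β) s = -β s + geodCurv β s • binormal β s := by
  conv_lhs => rw [eq_frame_expansion (h.norm_eq s hs) (h.norm_deriv s hs) (h.inner_deriv hs)
    (deriv (deriv β) s)]
  rw [h.inner_self_deriv_deriv hs, h.inner_deriv_deriv hs, geodCurv, binormal]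
  simp

theorem hasDerivAt_deriv (h : IsSphericalCurve I β) {s : ℝ} (hs : s ∈ I) :
    HasDerivAt (deriv β) (-β s + geodCurv β s • binormal β s) s :=
  h.deriv_deriv hs ▸ h.hasDerivAt_deriv' hs

theorem cross_binormal_left (h : IsSphericalCurve I β) {s : ℝ} (hs : s ∈ I) :
    cross (binormal β s) (β s) = deriv β s := by
  rw [binormal, cross_cross_left, h.inner_self hs, real_inner_comm, h.inner_deriv hs]
  simp

theorem hasDerivAt_binormal (h : IsSphericalCurve I β) {s : ℝ} (hs : s ∈ I) :
    HasDerivAt (binormal β) (-geodCurv β s • deriv β s) s := by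
  refine (hasDerivAt_cross (h.hasDerivAt hs) (h.hasDerivAt_deriv hs)).congr_deriv ?_
  rw [cross_self, cross_add_right, cross_smul_right, cross_anticomm (β s) (binormal β s),
    h.cross_binormal_left hs, cross_anticomm (β s) (-β s), ← neg_one_smul ℝ (β s),
    cross_smul_left, cross_self]
  simp

theorem inner_binormal_self (h : IsSphericalCurve I β) {s : ℝ} (hs : s ∈ I) :
    inner ℝ (binormal β s) (binormal β s) = 1 := by
  rw [binormal, inner_cross_self, h.inner_self hs, h.inner_deriv_self hs, h.inner_deriv hs]
  norm_num

theorem contDiffOn_binormal (h : IsSphericalCurve I β) : ContDiffOn ℝ ∞ (binormal β) I :=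
  contDiffOn_cross h.smooth (contDiffOn_deriv h.isOpen h.smooth)

theorem contDiffOn_geodCurv (h : IsSphericalCurve I β) : ContDiffOn ℝ ∞ (geodCurv β) I :=
  (contDiffOn_deriv h.isOpen (contDiffOn_deriv h.isOpen h.smooth)).inner ℝ h.contDiffOn_binormal

end IsSphericalCurve

/-! ### The mean curvature equation of a ruled surface -/

/-- The `β × β'`-component `b' + a k` of the derivative of the directrix; up to sign it is the
distribution parameter of the ruled surface. -/
def pitch (β : ℝ → E3) (a b : ℝ → ℝ) (s : ℝ) : ℝ := deriv b s + a s * geodCurv β s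

/-- The `β'`-component `a' - b k` of the derivative of the directrix: the point of striction of the
ruling is at `t = -offset`. -/
def offset (β : ℝ → E3) (a b : ℝ → ℝ) (s : ℝ) : ℝ := deriv a s - b s * geodCurv β s

/-- The normal `X_s × X_t` of the ruled surface. -/
def ruledNormal (β : ℝ → E3) (a b : ℝ → ℝ) (s t : ℝ) : E3 :=
  pitch β a b s • deriv β s - (t + offset β a b s) • binormal β s

section

variable {I : Set ℝ} {α β : ℝ → E3} {a b : ℝ → ℝ}

theorem dT_ruled (α β : ℝ → E3) (s t : ℝ) : dT (ruled α β) s t = β s := by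
  have h : HasDerivAt (fun t' => ruled α β s t') ((1 : ℝ) • β s) t :=
    ((hasDerivAt_id t).smul_const (β s)).const_add (α s)
  rw [dT, h.deriv, one_smul]

theorem dS_ruled (h : IsSphericalCurve I β) (ha : ContDiffOn ℝ ∞ a I) (hb : ContDiffOn ℝ ∞ b I)
    (hα : ∀ s ∈ I, α s = a s • deriv β s + b s • binormal β s) {s : ℝ} (hs : s ∈ I) (t : ℝ) :
    dS (ruled α β) s t = -a s • β s + (t + offset β a b s) • deriv β s
      + pitch β a b s • binormal β s := by
  have h1 := (hasDerivAt_of_contDiffOn h.isOpen ha hs).fun_smul (h.hasDerivAt_deriv hs)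
  have h2 := (hasDerivAt_of_contDiffOn h.isOpen hb hs).fun_smul (h.hasDerivAt_binormal hs)
  have h3 := (h1.fun_add h2).fun_add ((h.hasDerivAt hs).const_smul t)
  have h4 : HasDerivAt (fun s' => ruled α β s' t) _ s := h3.congr_of_eventuallyEq
    (Filter.eventually_of_mem (h.isOpen.mem_nhds hs) fun x hx => by simp only [ruled, hα x hx]; rfl)
  rw [dS, h4.deriv, offset, pitch]
  module

theorem cross_ruled (h : IsSphericalCurve I β) (ha : ContDiffOn ℝ ∞ a I) (hb : ContDiffOn ℝ ∞ b I)
    (hα : ∀ s ∈ I, α s = a s • deriv β s + b s • binormal β s) {s : ℝ} (hs : s ∈ I) (t : ℝ) :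
    cross (dS (ruled α β) s t) (dT (ruled α β) s t) = ruledNormal β a b s t := by
  rw [dS_ruled h ha hb hα hs, dT_ruled, cross_add_left, cross_add_left, cross_smul_left,
    cross_smul_left, cross_smul_left, cross_self, cross_anticomm (deriv β s),
    h.cross_binormal_left hs, ruledNormal, binormal]
  module

theorem contDiffOn_pitch (h : IsSphericalCurve I β) (ha : ContDiffOn ℝ ∞ a I)
    (hb : ContDiffOn ℝ ∞ b I) : ContDiffOn ℝ ∞ (pitch β a b) I :=
  (contDiffOn_deriv h.isOpen hb).add (ha.mul h.contDiffOn_geodCurv)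

theorem contDiffOn_offset (h : IsSphericalCurve I β) (ha : ContDiffOn ℝ ∞ a I)
    (hb : ContDiffOn ℝ ∞ b I) : ContDiffOn ℝ ∞ (offset β a b) I :=
  (contDiffOn_deriv h.isOpen ha).sub (hb.mul h.contDiffOn_geodCurv)

/-- The anisotropic mean curvature of a ruled surface: along a ruling, `Λ ⟨X_s × X_t, e₃⟩³` is a
quadratic polynomial in the distance `T` to the point of striction. -/
theorem anisotropicMeanCurvature_ruled (h : IsSphericalCurve I β) (ha : ContDiffOn ℝ ∞ a I)
    (hb : ContDiffOn ℝ ∞ b I) (hα : ∀ s ∈ I, α s = a s • deriv β s + b s • binormal β s)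
    {s : ℝ} (hs : s ∈ I) {t T B C G Q k : ℝ} (hT : t + offset β a b s = T) (hB : β s 2 = B)
    (hC : deriv β s 2 = C) (hG : binormal β s 2 = G) (hQ : pitch β a b s = Q)
    (hk : geodCurv β s = k) (hne : Q * C - T * G ≠ 0) :
    anisotropicMeanCurvature dirichletDensity (ruled α β) s t * (Q * C - T * G) ^ 3
      = -2 * (k * (C ^ 2 + G ^ 2) * T ^ 2
          + (deriv (pitch β a b) s * (C ^ 2 + G ^ 2) - 2 * Q * B * C) * T
          + Q * ((Q * k - deriv (offset β a b) s - a s) * (C ^ 2 + G ^ 2) - 2 * Q * G * B)) := by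
  have hW : Q ^ 2 + T ^ 2 ≠ 0 := by
    intro h0
    have hQ0 : Q = 0 := pow_eq_zero_iff two_ne_zero |>.1 (by linarith [sq_nonneg Q, sq_nonneg T])
    have hT0 : T = 0 := pow_eq_zero_iff two_ne_zero |>.1 (by linarith [sq_nonneg Q, sq_nonneg T])
    simp [hQ0, hT0] at hne
  apply mul_left_cancel₀ hW
  set Q' := deriv (pitch β a b) s
  set h' := deriv (offset β a b) s
  have hQ' : HasDerivAt (pitch β a b) Q' s :=
    hasDerivAt_of_contDiffOn h.isOpen (contDiffOn_pitch h ha hb) hs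
  have hh' : HasDerivAt (offset β a b) h' s :=
    hasDerivAt_of_contDiffOn h.isOpen (contDiffOn_offset h ha hb) hs
  have hNs := (hQ'.fun_smul (h.hasDerivAt_deriv hs)).fun_sub
    ((hh'.const_add t).fun_smul (h.hasDerivAt_binormal hs))
  have hNt : HasDerivAt (fun t' => ruledNormal β a b s t') (-binormal β s) t := by
    rw [← one_smul ℝ (binormal β s)]
    exact (((hasDerivAt_id t).add_const (offset β a b s)).smul_const (binormal β s)).const_sub
      (pitch β a b s • deriv β s)
  have hN2 : ruledNormal β a b s t 2 = Q * C - T * G := by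
    simp [ruledNormal, hT, hQ, hC, hG]
  have key := anisotropicMeanCurvature_mul (X := ruled α β) (N := ruledNormal β a b)
    (Filter.eventually_of_mem (h.isOpen.mem_nhds hs) fun x hx => cross_ruled h ha hb hα hx t)
    (Filter.Eventually.of_forall fun t' => cross_ruled h ha hb hα hs t') hNs hNt (hN2 ▸ hne)
  rw [hN2, dS_ruled h ha hb hα hs, dT_ruled] at key
  have e1 := h.inner_self hs
  have e2 := h.inner_deriv_self hs
  have e3 := h.inner_binormal_self hs
  have e4 := h.inner_deriv hs
  have e5 : inner ℝ (β s) (binormal β s) = 0 := inner_cross_left _ _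
  have e6 : inner ℝ (deriv β s) (binormal β s) = 0 := inner_cross_right _ _
  have e4' : inner ℝ (deriv β s) (β s) = 0 := by rw [real_inner_comm, e4]
  have e5' : inner ℝ (binormal β s) (β s) = 0 := by rw [real_inner_comm, e5]
  have e6' : inner ℝ (binormal β s) (deriv β s) = 0 := by rw [real_inner_comm, e6]
  simp only [divNum, ruledNormal, inner_add_left, inner_add_right, inner_sub_left, inner_sub_right,
    real_inner_smul_left, real_inner_smul_right, inner_neg_left, inner_neg_right, e1, e2, e3, e4,
    e5, e6, e4', e5', e6', inner_e₃, PiLp.add_apply, PiLp.sub_apply, PiLp.neg_apply,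
    PiLp.smul_apply, smul_eq_mul, hT, hQ, hk, hB, hC, hG] at key
  linear_combination key

end

/-! ### The equations for the frame, and their global consequences -/

/-- If a quadratic polynomial equals `Λ (P - T G)³` wherever the affine function `P - T G`, which
is not identically zero, does not vanish, then both sides are constant.  Multiplication by `P - T G`
gives an identity for all `T`. -/
theorem coeff_eq_zero_of_cubic {Λ P G c₀ c₁ c₂ : ℝ} (hne : G ≠ 0 ∨ P ≠ 0)
    (h : ∀ T : ℝ, P - T * G ≠ 0 → Λ * (P - T * G) ^ 3 = c₂ * T ^ 2 + c₁ * T + c₀) :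
    Λ * G = 0 ∧ c₂ = 0 ∧ c₁ = 0 ∧ c₀ = Λ * P ^ 3 := by
  have h' : ∀ T : ℝ, (P - T * G) * (Λ * (P - T * G) ^ 3 - (c₂ * T ^ 2 + c₁ * T + c₀)) = 0 := by
    intro T
    by_cases hT : P - T * G = 0
    · rw [hT, zero_mul]
    · rw [h T hT, sub_self, mul_zero]
  have h0 := h' 0
  have h1 := h' 1
  have h2 := h' (-1)
  have h3 := h' 2
  have h4 := h' (-2)
  have k4 : Λ * G ^ 4 = 0 := by linarith
  have hΛG : Λ * G = 0 := by
    rcases mul_eq_zero.1 k4 with h | h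
    · simp [h]
    · simp [pow_eq_zero_iff (four_ne_zero) |>.1 h]
  have k3 : G * c₂ = 4 * (Λ * G) * P * G ^ 2 := by linarith
  have k2 : P * c₂ - G * c₁ = 6 * (Λ * G) * P ^ 2 * G := by linarith
  have k1 : P * c₁ - G * c₀ = - 4 * (Λ * G) * P ^ 3 := by linarith
  have k0 : P * (Λ * P ^ 3 - c₀) = 0 := by linarith
  rw [hΛG] at k3 k2 k1
  refine ⟨hΛG, ?_⟩
  by_cases hG : G = 0
  · have hP : P ≠ 0 := hne.resolve_left (not_not.2 hG)
    simp only [hG, zero_mul, mul_zero, sub_zero, mul_eq_zero, hP, false_or] at k2 k1 k0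
    exact ⟨k2, k1, by linarith⟩
  · have hΛ : Λ = 0 := (mul_eq_zero.1 hΛG).resolve_right hG
    have e2 : c₂ = 0 := by simpa [hG] using k3
    have e1 : c₁ = 0 := by simpa [hG, e2] using k2
    have e0 : c₀ = 0 := by simpa [hG, e1] using k1
    exact ⟨e2, e1, by rw [e0, hΛ, zero_mul]⟩

/-- The ruled surface `a β' + b β × β' + t β` has constant anisotropic mean curvature `Λ` at its
points with nonzero third component of the normal, and there is such a point. -/
structure IsDirichletRuled (I : Set ℝ) (α β : ℝ → E3) (a b : ℝ → ℝ) (Λ : ℝ) : Prop where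
  curve : IsSphericalCurve I β
  ordConnected : I.OrdConnected
  smooth_a : ContDiffOn ℝ ∞ a I
  smooth_b : ContDiffOn ℝ ∞ b I
  directrix_eq : ∀ s ∈ I, α s = a s • deriv β s + b s • binormal β s
  exists_graph : ∃ s ∈ I, ∃ t : ℝ, unitNormal (ruled α β) s t 2 ≠ 0
  curvature_eq : ∀ s ∈ I, ∀ t : ℝ, unitNormal (ruled α β) s t 2 ≠ 0 →
    anisotropicMeanCurvature dirichletDensity (ruled α β) s t = Λ

theorem eq_of_hasDerivAt_zero {E : Type*} [NormedAddCommGroup E] [NormedSpace ℝ E] {I : Set ℝ}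
    (hI : IsOpen I) (hc : I.OrdConnected) {f : ℝ → E} (hf : ∀ s ∈ I, HasDerivAt f 0 s) {x y : ℝ}
    (hx : x ∈ I) (hy : y ∈ I) : f x = f y :=
  hI.is_const_of_deriv_eq_zero hc.isPreconnected
    (fun s hs => (hf s hs).differentiableAt.differentiableWithinAt) (fun s hs => (hf s hs).deriv)
    hx hy

theorem ruledNormal_two (β : ℝ → E3) (a b : ℝ → ℝ) (s t : ℝ) : ruledNormal β a b s t 2
    = pitch β a b s * deriv β s 2 - (t + offset β a b s) * binormal β s 2 := by
  simp [ruledNormal]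

theorem hasDerivAt_two {f : ℝ → E3} {f' : E3} {x : ℝ} (hf : HasDerivAt f f' x) :
    HasDerivAt (fun s => f s 2) (f' 2) x :=
  hasDerivAt_coord_iff.1 hf 2

/-- `(b' + a k) (1 - β₃²)`, which is constant on a ruled surface of constant anisotropic mean
curvature. -/
def flux (β : ℝ → E3) (a b : ℝ → ℝ) (s : ℝ) : ℝ :=
  pitch β a b s * (deriv β s 2 ^ 2 + binormal β s 2 ^ 2)

namespace IsDirichletRuled

variable {I : Set ℝ} {α β : ℝ → E3} {a b : ℝ → ℝ} {Λ : ℝ}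

theorem unitNormal_two_ne_zero_iff (h : IsDirichletRuled I α β a b Λ) {s : ℝ} (hs : s ∈ I) (t : ℝ) :
    unitNormal (ruled α β) s t 2 ≠ 0 ↔
      pitch β a b s * deriv β s 2 - (t + offset β a b s) * binormal β s 2 ≠ 0 := by
  rw [unitNormal_two, cross_ruled h.curve h.smooth_a h.smooth_b h.directrix_eq hs,
    ← ruledNormal_two]
  refine ⟨right_ne_zero_of_mul, fun h3 => mul_ne_zero (inv_ne_zero (norm_ne_zero_of_two h3)) h3⟩

/-- The equations at a parameter whose ruling carries a point with nonvertical tangent plane. -/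
theorem equations (h : IsDirichletRuled I α β a b Λ) {s : ℝ} (hs : s ∈ I)
    (hne : binormal β s 2 ≠ 0 ∨ pitch β a b s * deriv β s 2 ≠ 0) :
    Λ * binormal β s 2 = 0 ∧ geodCurv β s = 0 ∧ deriv β s 2 ^ 2 + binormal β s 2 ^ 2 ≠ 0 ∧
    deriv (pitch β a b) s * (deriv β s 2 ^ 2 + binormal β s 2 ^ 2)
      = 2 * pitch β a b s * β s 2 * deriv β s 2 ∧
    2 * pitch β a b s * ((deriv (offset β a b) s + a s)
        * (deriv β s 2 ^ 2 + binormal β s 2 ^ 2) + 2 * pitch β a b s * binormal β s 2 * β s 2)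
      = Λ * (pitch β a b s * deriv β s 2) ^ 3 := by
  have hD : deriv β s 2 ^ 2 + binormal β s 2 ^ 2 ≠ 0 := by
    rcases hne with h | h
    · positivity
    · have := right_ne_zero_of_mul h
      positivity
  obtain ⟨h1, h2, h3, h4⟩ := coeff_eq_zero_of_cubic (Λ := Λ) hne
    (c₂ := -2 * (geodCurv β s * (deriv β s 2 ^ 2 + binormal β s 2 ^ 2)))
    (c₁ := -2 * (deriv (pitch β a b) s * (deriv β s 2 ^ 2 + binormal β s 2 ^ 2)
      - 2 * pitch β a b s * β s 2 * deriv β s 2))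
    (c₀ := -2 * (pitch β a b s * ((pitch β a b s * geodCurv β s - deriv (offset β a b) s - a s)
      * (deriv β s 2 ^ 2 + binormal β s 2 ^ 2) - 2 * pitch β a b s * binormal β s 2 * β s 2)))
    (fun T hT => by
      have hT' : T - offset β a b s + offset β a b s = T := by ring
      have := anisotropicMeanCurvature_ruled h.curve h.smooth_a h.smooth_b h.directrix_eq hs
        hT' rfl rfl rfl rfl rfl hT
      rw [h.curvature_eq s hs _ ((h.unitNormal_two_ne_zero_iff hs _).2 (by rwa [hT']))] at this
      rw [this]
      ring)
  have hk : geodCurv β s = 0 := by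
    have : geodCurv β s * (deriv β s 2 ^ 2 + binormal β s 2 ^ 2) = 0 := by linarith
    exact (mul_eq_zero.1 this).resolve_right hD
  refine ⟨h1, hk, hD, by linarith, ?_⟩
  rw [← h4, hk]
  ring

theorem hasDerivAt_binormal_two (h : IsDirichletRuled I α β a b Λ) {s : ℝ} (hs : s ∈ I) :
    HasDerivAt (fun s => binormal β s 2) (-geodCurv β s * deriv β s 2) s := by
  simpa using hasDerivAt_two (h.curve.hasDerivAt_binormal hs)

theorem hasDerivAt_flux (h : IsDirichletRuled I α β a b Λ) {s : ℝ} (hs : s ∈ I) :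
    HasDerivAt (flux β a b) (deriv (pitch β a b) s * (deriv β s 2 ^ 2 + binormal β s 2 ^ 2)
      - 2 * pitch β a b s * β s 2 * deriv β s 2) s := by
  have h1 := hasDerivAt_two (h.curve.hasDerivAt_deriv hs)
  have h2 := h.hasDerivAt_binormal_two hs
  have h3 := hasDerivAt_of_contDiffOn h.curve.isOpen
    (contDiffOn_pitch h.curve h.smooth_a h.smooth_b) hs
  refine (h3.fun_mul ((h1.fun_pow 2).fun_add (h2.fun_pow 2))).congr_deriv ?_
  simp only [PiLp.add_apply, PiLp.neg_apply, PiLp.smul_apply, smul_eq_mul]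
  ring

/-- Every ruling carries a point with nonvertical tangent plane: the square sum of `⟨β × β', e₃⟩`
and of the flux vanishes exactly at the other rulings, and has derivative zero everywhere. -/
theorem nondegenerate (h : IsDirichletRuled I α β a b Λ) {s : ℝ} (hs : s ∈ I) :
    binormal β s 2 ≠ 0 ∨ pitch β a b s * deriv β s 2 ≠ 0 := by
  have hd : ∀ x ∈ I, HasDerivAt (fun s => binormal β s 2 ^ 2 + flux β a b s ^ 2) 0 x := by
    intro x hx
    refine (((h.hasDerivAt_binormal_two hx).fun_pow 2).fun_add
      ((h.hasDerivAt_flux hx).fun_pow 2)).congr_deriv ?_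
    by_cases hne : binormal β x 2 ≠ 0 ∨ pitch β a b x * deriv β x 2 ≠ 0
    · obtain ⟨-, hk, -, hq, -⟩ := h.equations hx hne
      rw [hk, hq]
      simp
    · push Not at hne
      have hf : flux β a b x = 0 := by
        rw [flux, hne.1]
        linear_combination deriv β x 2 * hne.2
      rw [hf, hne.1]
      simp
  by_contra hcon
  push Not at hcon
  obtain ⟨x, hx, t, ht⟩ := h.exists_graph
  rw [h.unitNormal_two_ne_zero_iff hx] at ht
  have hc := eq_of_hasDerivAt_zero h.curve.isOpen h.ordConnected hd hx hs
  have hf : flux β a b s = 0 := by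
    rw [flux, hcon.1]
    linear_combination deriv β s 2 * hcon.2
  simp only [hf, hcon.1] at hc
  have h1 : binormal β x 2 = 0 :=
    pow_eq_zero_iff two_ne_zero |>.1 (by nlinarith [sq_nonneg (flux β a b x)])
  have h2 : flux β a b x = 0 :=
    pow_eq_zero_iff two_ne_zero |>.1 (by nlinarith [sq_nonneg (binormal β x 2)])
  rw [flux, h1] at h2
  rw [h1] at ht
  have h3 : pitch β a b x * deriv β x 2 ≠ 0 := by simpa using ht
  have h4 : (pitch β a b x * deriv β x 2) * deriv β x 2 = 0 := by linear_combination h2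
  exact mul_ne_zero h3 (right_ne_zero_of_mul h3) h4

theorem geodCurv_eq_zero (h : IsDirichletRuled I α β a b Λ) {s : ℝ} (hs : s ∈ I) :
    geodCurv β s = 0 :=
  (h.equations hs (h.nondegenerate hs)).2.1

theorem binormal_eq (h : IsDirichletRuled I α β a b Λ) {s s' : ℝ} (hs : s ∈ I) (hs' : s' ∈ I) :
    binormal β s = binormal β s' :=
  eq_of_hasDerivAt_zero h.curve.isOpen h.ordConnected
    (fun x hx => by simpa [h.geodCurv_eq_zero hx] using h.curve.hasDerivAt_binormal hx) hs hs'

theorem flux_eq (h : IsDirichletRuled I α β a b Λ) {s s' : ℝ} (hs : s ∈ I) (hs' : s' ∈ I) :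
    flux β a b s = flux β a b s' :=
  eq_of_hasDerivAt_zero h.curve.isOpen h.ordConnected
    (fun x hx => (h.hasDerivAt_flux hx).congr_deriv (by
      rw [(h.equations hx (h.nondegenerate hx)).2.2.2.1, sub_self])) hs hs'

theorem pitch_eq (h : IsDirichletRuled I α β a b Λ) {s : ℝ} (hs : s ∈ I) :
    pitch β a b s = deriv b s := by
  rw [pitch, h.geodCurv_eq_zero hs, mul_zero, add_zero]

theorem deriv_offset (h : IsDirichletRuled I α β a b Λ) {s : ℝ} (hs : s ∈ I) :
    deriv (offset β a b) s = deriv (deriv a) s := by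
  refine Filter.EventuallyEq.deriv_eq (Filter.eventually_of_mem (h.curve.isOpen.mem_nhds hs) ?_)
  intro x hx
  rw [offset, h.geodCurv_eq_zero hx, mul_zero, sub_zero]

theorem hasDerivAt_deriv (h : IsDirichletRuled I α β a b Λ) {s : ℝ} (hs : s ∈ I) :
    HasDerivAt (deriv β) (-β s) s := by
  simpa [h.geodCurv_eq_zero hs] using h.curve.hasDerivAt_deriv hs

theorem inGreatCircle (h : IsDirichletRuled I α β a b Λ) : InGreatCircle I β := by
  obtain ⟨s₀, hs₀, -⟩ := h.exists_graph
  refine ⟨binormal β s₀, ?_, fun s hs => ⟨h.curve.norm_eq s hs, ?_⟩⟩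
  · have := h.curve.inner_binormal_self hs₀
    rw [real_inner_self_eq_norm_sq] at this
    exact (pow_eq_one_iff_of_nonneg (norm_nonneg _) two_ne_zero).1 this
  · rw [h.binormal_eq hs₀ hs, binormal, real_inner_comm, inner_cross_left]

theorem isPlanar (h : IsDirichletRuled I α β a b Λ) (hq : ∀ s ∈ I, flux β a b s = 0) :
    IsPlanar I (ruled α β) := by
  obtain ⟨s₀, hs₀, -⟩ := h.exists_graph
  refine ⟨binormal β s₀, b s₀, ?_, fun s hs t => ?_⟩
  · intro h0
    have := h.curve.inner_binormal_self hs₀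
    simp [h0] at this
  · have hb : b s = b s₀ := by
      refine eq_of_hasDerivAt_zero h.curve.isOpen h.ordConnected (fun x hx => ?_) hs hs₀
      refine (hasDerivAt_of_contDiffOn h.curve.isOpen h.smooth_b hx).congr_deriv ?_
      rw [← h.pitch_eq hx]
      exact (mul_eq_zero.1 (hq x hx)).resolve_right (h.equations hx (h.nondegenerate hx)).2.2.1
    have e5 : inner ℝ (binormal β s) (β s) = 0 := by
      rw [binormal, real_inner_comm, inner_cross_left]
    have e6 : inner ℝ (binormal β s) (deriv β s) = 0 := by
      rw [binormal, real_inner_comm, inner_cross_right]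
    rw [h.binormal_eq hs₀ hs, ruled, h.directrix_eq s hs, inner_add_right, inner_add_right,
      real_inner_smul_right, real_inner_smul_right, real_inner_smul_right, e5, e6,
      h.curve.inner_binormal_self hs, hb]
    ring

end IsDirichletRuled

/-! ### Comparison of ruled surfaces along great circles -/

theorem rotZ_add (θ : ℝ) (x y : E3) : rotZ θ (x + y) = rotZ θ x + rotZ θ y := by
  apply ext_coord <;> simp [rotZ] <;> ring

theorem rotZ_smul (θ c : ℝ) (x : E3) : rotZ θ (c • x) = c • rotZ θ x := by
  apply ext_coord <;> simp [rotZ] <;> ring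

theorem rotZ_two (θ : ℝ) (x : E3) : rotZ θ x 2 = x 2 := by
  simp [rotZ]

theorem rotZ_cross (θ : ℝ) (x y : E3) : rotZ θ (cross x y) = cross (rotZ θ x) (rotZ θ y) := by
  apply ext_coord
  · simp [rotZ, cross_zero, cross_one, cross_two]
    ring
  · simp [rotZ, cross_zero, cross_one, cross_two]
    ring
  · simp [rotZ, cross_zero, cross_one, cross_two]
    linear_combination (x 1 * y 0 - x 0 * y 1) * Real.sin_sq_add_cos_sq θ

theorem inner_rotZ (θ : ℝ) (x y : E3) : inner ℝ (rotZ θ x) (rotZ θ y) = inner ℝ x y := by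
  simp [rotZ, inner_eq_sum]
  linear_combination (x 0 * y 0 + x 1 * y 1) * Real.sin_sq_add_cos_sq θ

theorem hasDerivAt_rotZ (θ : ℝ) {f : ℝ → E3} {f' : E3} {x : ℝ} (hf : HasDerivAt f f' x) :
    HasDerivAt (fun s => rotZ θ (f s)) (rotZ θ f') x := by
  have hf' := hasDerivAt_coord_iff.1 hf
  refine hasDerivAt_of_coord ?_ ?_ ?_
  · simpa [rotZ] using ((hf' 0).const_mul (Real.cos θ)).fun_sub ((hf' 1).const_mul (Real.sin θ))
  · simpa [rotZ] using ((hf' 0).const_mul (Real.sin θ)).fun_add ((hf' 1).const_mul (Real.cos θ))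
  · simpa [rotZ] using hf' 2

theorem hasDerivAt_affine (σ s₀ s : ℝ) : HasDerivAt (fun s => σ * s + s₀) σ s := by
  simpa using ((hasDerivAt_id s).const_mul σ).add_const s₀

namespace IsDirichletRuled

variable {I : Set ℝ} {α β : ℝ → E3} {a b : ℝ → ℝ} {Λ : ℝ}

/-- Along a great circle, the directrix is determined up to a translation of `ℝ³` by `b'` and
`a'' + a`: if `d'' + d = 0`, then `d β' - d' β` is a constant vector. -/
theorem sameUpToMotion (h : IsDirichletRuled I α β a b Λ) {θ σ s₀ : ℝ} {βm : ℝ → E3}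
    {am am' am₂ bm : ℝ → ℝ} (hσ : σ = 1 ∨ σ = -1) (hβm : Differentiable ℝ βm)
    (hR : ∀ s ∈ I, rotZ θ (β s) = βm (σ * s + s₀))
    (ham : ∀ s ∈ I, HasDerivAt am (am' (σ * s + s₀)) (σ * s + s₀))
    (ham' : ∀ s ∈ I, HasDerivAt am' (am₂ (σ * s + s₀)) (σ * s + s₀))
    (hsum : ∀ s ∈ I, am₂ (σ * s + s₀) + am (σ * s + s₀) = σ * (deriv (deriv a) s + a s))
    (hbm : ∀ s ∈ I, HasDerivAt bm (deriv b s) (σ * s + s₀)) :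
    SameUpToMotion I α β ((fun s => σ * s + s₀) '' I) βm am bm := by
  have hσ2 : σ * σ = 1 := by rcases hσ with rfl | rfl <;> norm_num
  have hI := h.curve.isOpen
  have hβm' : ∀ s ∈ I, deriv βm (σ * s + s₀) = σ • rotZ θ (deriv β s) := by
    intro s hs
    have h1 : HasDerivAt (fun s => βm (σ * s + s₀)) (σ • deriv βm (σ * s + s₀)) s :=
      HasDerivAt.scomp s (hβm (σ * s + s₀)).hasDerivAt (hasDerivAt_affine σ s₀ s)
    have h2 : HasDerivAt (fun s => βm (σ * s + s₀)) (rotZ θ (deriv β s)) s :=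
      (hasDerivAt_rotZ θ (h.curve.hasDerivAt hs)).congr_of_eventuallyEq
        (Filter.eventually_of_mem (hI.mem_nhds hs) fun x hx => (hR x hx).symm)
    rw [← h1.unique h2, smul_smul, hσ2, one_smul]
  set V : ℝ → E3 := fun s => (σ * am (σ * s + s₀) - a s) • deriv β s
    - (am' (σ * s + s₀) - deriv a s) • β s + (σ * bm (σ * s + s₀) - b s) • binormal β s with hV
  have hV' : ∀ s ∈ I, HasDerivAt V 0 s := by
    intro s hs
    have ha1 := hasDerivAt_of_contDiffOn hI h.smooth_a hs
    have ha2 := hasDerivAt_of_contDiffOn hI (contDiffOn_deriv hI h.smooth_a) hs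
    have hb1 := hasDerivAt_of_contDiffOn hI h.smooth_b hs
    have hu := hasDerivAt_affine σ s₀ s
    have k1 := (((ham s hs).comp s hu).const_mul σ).fun_sub ha1
    have k2 := ((ham' s hs).comp s hu).fun_sub ha2
    have k3 := (((hbm s hs).comp s hu).const_mul σ).fun_sub hb1
    have hγ := h.curve.hasDerivAt_binormal hs
    rw [h.geodCurv_eq_zero hs, neg_zero, zero_smul] at hγ
    refine (((k1.fun_smul (h.hasDerivAt_deriv hs)).fun_sub
      (k2.fun_smul (h.curve.hasDerivAt hs))).fun_add (k3.fun_smul hγ)).congr_deriv ?_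
    have e1 : σ * (am' (σ * s + s₀) * σ) - deriv a s = am' (σ * s + s₀) - deriv a s := by
      linear_combination am' (σ * s + s₀) * hσ2
    have e2 : σ * (deriv b s * σ) - deriv b s = 0 := by linear_combination deriv b s * hσ2
    have e3 : am₂ (σ * s + s₀) * σ - deriv (deriv a) s = -(σ * am (σ * s + s₀) - a s) := by
      linear_combination σ * hsum s hs + (deriv (deriv a) s + a s) * hσ2
    simp only [Function.comp_apply, e1, e2, e3]
    module
  obtain ⟨s₁, hs₁, -⟩ := h.exists_graph
  refine ⟨θ, rotZ θ (V s₁), σ, s₀, fun s => deriv a s - am' (σ * s + s₀), hσ, rfl, hR, ?_⟩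
  intro s hs t
  rw [eq_of_hasDerivAt_zero hI h.ordConnected hV' hs₁ hs, ruled, ruled, directrix, hβm' s hs,
    ← hR s hs, cross_smul_right, ← rotZ_cross, ← rotZ_smul, ← rotZ_smul, ← rotZ_smul, ← rotZ_smul,
    ← rotZ_smul, ← rotZ_add, ← rotZ_add, ← rotZ_add, h.directrix_eq s hs, hV]
  congr 1
  simp only [binormal]
  module

end IsDirichletRuled

theorem exists_angle {x y : ℝ} (h : x ^ 2 + y ^ 2 = 1) :
    ∃ u ∈ Set.Ioc (-Real.pi) Real.pi, Real.cos u = x ∧ Real.sin u = y := by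
  have hn : ‖(⟨x, y⟩ : ℂ)‖ = 1 := by
    simp [Complex.norm_eq_sqrt_sq_add_sq, h]
  have h0 : (⟨x, y⟩ : ℂ) ≠ 0 := by
    rw [← norm_ne_zero_iff, hn]
    exact one_ne_zero
  exact ⟨Complex.arg ⟨x, y⟩, Complex.arg_mem_Ioc _, by simp [Complex.cos_arg h0, hn],
    by simp [Complex.sin_arg, hn]⟩

theorem exists_rotZ_eq (w : E3) : ∃ θ : ℝ, rotZ θ w = !₂[0, -√(w 0 ^ 2 + w 1 ^ 2), w 2] := by
  set r := √(w 0 ^ 2 + w 1 ^ 2) with hr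
  have hr2 : r ^ 2 = w 0 ^ 2 + w 1 ^ 2 := Real.sq_sqrt (by positivity)
  by_cases hr0 : r = 0
  · rw [hr0] at hr2
    have h0 : w 0 = 0 := pow_eq_zero_iff two_ne_zero |>.1 (by nlinarith [sq_nonneg (w 1)])
    have h1 : w 1 = 0 := pow_eq_zero_iff two_ne_zero |>.1 (by nlinarith [sq_nonneg (w 0)])
    exact ⟨0, by apply ext_coord <;> simp [rotZ, h0, h1, hr0]⟩
  · obtain ⟨θ, -, hc, hs⟩ := exists_angle (x := -w 1 / r) (y := -w 0 / r) (by
      field_simp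
      linarith)
    refine ⟨θ, ?_⟩
    apply ext_coord
    · simp [rotZ, hc, hs]
      ring
    · simp [rotZ, hc, hs]
      field_simp
      linarith
    · simp [rotZ]

/-- The great circle with horizontal diameter along the `x`-axis and normal `(0, -m, g)`, where
`m² + g² = 1`; it comprises the horizontal and the vertical equator. -/
def greatCircle (g m u : ℝ) : E3 := !₂[Real.cos u, g * Real.sin u, m * Real.sin u]

theorem differentiable_greatCircle (g m : ℝ) : Differentiable ℝ (greatCircle g m) := by
  intro u
  refine (hasDerivAt_of_coord (f' := !₂[-Real.sin u, g * Real.cos u, m * Real.cos u])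
    ?_ ?_ ?_).differentiableAt
  · simpa [greatCircle] using Real.hasDerivAt_cos u
  · simpa [greatCircle] using (Real.hasDerivAt_sin u).const_mul g
  · simpa [greatCircle] using (Real.hasDerivAt_sin u).const_mul m

namespace IsDirichletRuled

variable {I : Set ℝ} {α β : ℝ → E3} {a b : ℝ → ℝ} {Λ : ℝ}

/-- After a rotation about the `z`-axis and an affine change of parameter, the rulings follow a
`greatCircle`.  The orientation `σ` is chosen such that the normal of the circle points upwards, or,
for a vertical circle, such that the third component of `β` increases. -/
theorem exists_greatCircle (h : IsDirichletRuled I α β a b Λ) :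
    ∃ θ σ s₀ g m : ℝ, (σ = 1 ∨ σ = -1) ∧ 0 ≤ g ∧ 0 ≤ m ∧ g ^ 2 + m ^ 2 = 1 ∧
      (∀ s ∈ I, rotZ θ (β s) = greatCircle g m (σ * s + s₀)) ∧
      (∀ s ∈ I, deriv β s 2 = σ * (m * Real.cos (σ * s + s₀))) ∧
      (∀ s ∈ I, binormal β s 2 = σ * g) ∧
      (g = 0 → ∀ s ∈ I, σ * s + s₀ ∈ Set.Ioo (-(Real.pi / 2)) (Real.pi / 2)) := by
  obtain ⟨s₁, hs₁, -⟩ := h.exists_graph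
  obtain ⟨σ, hσ, hg, hgC⟩ : ∃ σ : ℝ, (σ = 1 ∨ σ = -1) ∧ 0 ≤ σ * binormal β s₁ 2 ∧
      (σ * binormal β s₁ 2 = 0 → 0 < σ * deriv β s₁ 2) := by
    rcases lt_trichotomy (binormal β s₁ 2) 0 with hG | hG | hG
    · exact ⟨-1, Or.inr rfl, by linarith, fun h0 => absurd h0 (by linarith)⟩
    · have hC : deriv β s₁ 2 ≠ 0 :=
        right_ne_zero_of_mul ((h.nondegenerate hs₁).resolve_left (not_not.2 hG))
      rcases lt_or_gt_of_ne hC with hC | hC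
      · exact ⟨-1, Or.inr rfl, by simp [hG], fun _ => by linarith⟩
      · exact ⟨1, Or.inl rfl, by simp [hG], fun _ => by linarith⟩
    · exact ⟨1, Or.inl rfl, by linarith, fun h0 => absurd h0 (by linarith)⟩
  have hσ2 : σ * σ = 1 := by rcases hσ with rfl | rfl <;> norm_num
  obtain ⟨θ, hθ⟩ := exists_rotZ_eq (σ • binormal β s₁)
  set g := (σ • binormal β s₁) 2 with hg_def
  set m := √((σ • binormal β s₁) 0 ^ 2 + (σ • binormal β s₁) 1 ^ 2) with hm_def
  have hgσ : g = σ * binormal β s₁ 2 := rfl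
  have hm : 0 ≤ m := Real.sqrt_nonneg _
  have hgm : g ^ 2 + m ^ 2 = 1 := by
    have h1 : inner ℝ (σ • binormal β s₁) (σ • binormal β s₁) = 1 := by
      rw [real_inner_smul_left, real_inner_smul_right, h.curve.inner_binormal_self hs₁, mul_one,
        hσ2]
    rw [inner_eq_sum] at h1
    rw [hm_def, Real.sq_sqrt (by positivity), hg_def]
    linarith
  have hRγ : ∀ s ∈ I, rotZ θ (binormal β s) = σ • !₂[0, -m, g] := by
    intro s hs
    rw [← hθ, rotZ_smul, smul_smul, hσ2, one_smul, h.binormal_eq hs hs₁]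
  set x : ℝ → ℝ := fun s => rotZ θ (β s) 0 with hx_def
  set p : ℝ → ℝ := fun s => g * rotZ θ (β s) 1 + m * rotZ θ (β s) 2 with hp_def
  have horth : ∀ s ∈ I, -m * rotZ θ (β s) 1 + g * rotZ θ (β s) 2 = 0 := by
    intro s hs
    have h1 : inner ℝ (σ • rotZ θ (binormal β s)) (rotZ θ (β s)) = 0 := by
      rw [real_inner_smul_left, inner_rotZ, binormal, real_inner_comm, inner_cross_left, mul_zero]
    rw [hRγ s hs, smul_smul, hσ2, one_smul, inner_eq_sum] at h1
    simpa using h1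
  have hy : ∀ s ∈ I, rotZ θ (β s) 1 = g * p s := fun s hs => by
    simp only [hp_def]
    linear_combination -rotZ θ (β s) 1 * hgm - m * horth s hs
  have hz : ∀ s ∈ I, rotZ θ (β s) 2 = m * p s := fun s hs => by
    simp only [hp_def]
    linear_combination -rotZ θ (β s) 2 * hgm + g * horth s hs
  have hRβ' : ∀ s ∈ I, rotZ θ (deriv β s) = σ • cross !₂[0, -m, g] (rotZ θ (β s)) := by
    intro s hs
    rw [← h.curve.cross_binormal_left hs, rotZ_cross, hRγ s hs, cross_smul_left]
  have hx' : ∀ s ∈ I, HasDerivAt x (-σ * p s) s := by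
    intro s hs
    refine (hasDerivAt_coord_iff.1 (hasDerivAt_rotZ θ (h.curve.hasDerivAt hs)) 0).congr_deriv ?_
    rw [hRβ' s hs, PiLp.smul_apply, cross_zero, smul_eq_mul]
    simp [hp_def]
    ring
  have hp' : ∀ s ∈ I, HasDerivAt p (σ * x s) s := by
    intro s hs
    have hd := hasDerivAt_coord_iff.1 (hasDerivAt_rotZ θ (h.curve.hasDerivAt hs))
    refine (((hd 1).const_mul g).fun_add ((hd 2).const_mul m)).congr_deriv ?_
    rw [hRβ' s hs, PiLp.smul_apply, PiLp.smul_apply, cross_one, cross_two, smul_eq_mul, smul_eq_mul]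
    simp [hx_def]
    linear_combination σ * rotZ θ (β s) 0 * hgm
  have hxp : x s₁ ^ 2 + p s₁ ^ 2 = 1 := by
    have h1 := inner_rotZ θ (β s₁) (β s₁)
    rw [h.curve.inner_self hs₁, inner_eq_sum, hy s₁ hs₁, hz s₁ hs₁] at h1
    simp only [hx_def]
    linear_combination h1 - p s₁ ^ 2 * hgm
  obtain ⟨u, hu, hcu, hsu⟩ := exists_angle hxp
  set s₀ := u - σ * s₁ with hs₀
  have hu₁ : σ * s₁ + s₀ = u := by rw [hs₀]; ring
  have hA : ∀ s ∈ I, x s * Real.cos (σ * s + s₀) + p s * Real.sin (σ * s + s₀) = 1 := by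
    intro s hs
    have hd : ∀ s ∈ I, HasDerivAt
        (fun s => x s * Real.cos (σ * s + s₀) + p s * Real.sin (σ * s + s₀)) 0 s := by
      intro s hs
      have hu := hasDerivAt_affine σ s₀ s
      refine (((hx' s hs).fun_mul hu.cos).fun_add ((hp' s hs).fun_mul hu.sin)).congr_deriv ?_
      ring
    have := eq_of_hasDerivAt_zero h.curve.isOpen h.ordConnected hd hs hs₁
    simp only [hu₁, hcu, hsu] at this
    rw [this]
    linarith
  have hB : ∀ s ∈ I, p s * Real.cos (σ * s + s₀) - x s * Real.sin (σ * s + s₀) = 0 := by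
    intro s hs
    have hd : ∀ s ∈ I, HasDerivAt
        (fun s => p s * Real.cos (σ * s + s₀) - x s * Real.sin (σ * s + s₀)) 0 s := by
      intro s hs
      have hu := hasDerivAt_affine σ s₀ s
      refine (((hp' s hs).fun_mul hu.cos).fun_sub ((hx' s hs).fun_mul hu.sin)).congr_deriv ?_
      ring
    have := eq_of_hasDerivAt_zero h.curve.isOpen h.ordConnected hd hs hs₁
    simp only [hu₁, hcu, hsu] at this
    rw [this]
    ring
  have hxc : ∀ s ∈ I, x s = Real.cos (σ * s + s₀) := fun s hs => by
    linear_combination Real.cos (σ * s + s₀) * hA s hs - Real.sin (σ * s + s₀) * hB s hs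
      - x s * Real.sin_sq_add_cos_sq (σ * s + s₀)
  have hps : ∀ s ∈ I, p s = Real.sin (σ * s + s₀) := fun s hs => by
    linear_combination Real.sin (σ * s + s₀) * hA s hs + Real.cos (σ * s + s₀) * hB s hs
      - p s * Real.sin_sq_add_cos_sq (σ * s + s₀)
  have hC : ∀ s ∈ I, deriv β s 2 = σ * (m * Real.cos (σ * s + s₀)) := by
    intro s hs
    rw [← rotZ_two θ, hRβ' s hs, PiLp.smul_apply, cross_two, ← hxc s hs, smul_eq_mul]
    simp [hx_def]
  have hG : ∀ s ∈ I, binormal β s 2 = σ * g := by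
    intro s hs
    rw [h.binormal_eq hs hs₁, hgσ, ← mul_assoc, hσ2, one_mul]
  refine ⟨θ, σ, s₀, g, m, hσ, hg, hm, hgm, fun s hs => ?_, hC, hG, fun hg0 s hs => ?_⟩
  · apply ext_coord
    · simpa [greatCircle] using hxc s hs
    · simpa [greatCircle, hps s hs] using hy s hs
    · simpa [greatCircle, hps s hs] using hz s hs
  · have hcos : ∀ y ∈ I, Real.cos (σ * y + s₀) ≠ 0 := by
      intro y hy h0
      rcases h.nondegenerate hy with h1 | h1
      · rw [hG y hy, hg0] at h1
        simp at h1
      · rw [hC y hy, h0] at h1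
        simp at h1
    have hcos₁ : 0 < Real.cos u := by
      have h1 := hgC (by rw [← hgσ, hg0])
      rw [hC s₁ hs₁, ← mul_assoc, hσ2, one_mul, hu₁] at h1
      exact pos_of_mul_pos_right h1 hm
    have hconn : ((fun y => σ * y + s₀) '' I).OrdConnected :=
      (h.ordConnected.isPreconnected.image _ (by fun_prop)).ordConnected
    have hmem : ∀ y ∈ I, σ * y + s₀ ∈ (fun y => σ * y + s₀) '' I := fun y hy => ⟨y, hy, rfl⟩
    have hpi := Real.pi_pos
    have hu2 : u ∈ Set.Ioo (-(Real.pi / 2)) (Real.pi / 2) := by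
      constructor
      · by_contra hcon
        have := Real.cos_nonpos_of_pi_div_two_le_of_le (x := -u) (by linarith)
          (by linarith [hu.1])
        rw [Real.cos_neg] at this
        linarith
      · by_contra hcon
        have := Real.cos_nonpos_of_pi_div_two_le_of_le (x := u) (by linarith)
          (by linarith [hu.2])
        linarith
    constructor
    · by_contra hcon
      obtain ⟨y, hy, hyu⟩ := hconn.out (hmem s hs) (hmem s₁ hs₁)
        (show -(Real.pi / 2) ∈ Set.Icc _ _ from ⟨by linarith, by linarith [hu2.1]⟩)
      exact hcos y hy (by rw [show σ * y + s₀ = -(Real.pi / 2) from hyu]; simp)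
    · by_contra hcon
      obtain ⟨y, hy, hyu⟩ := hconn.out (hmem s₁ hs₁) (hmem s hs)
        (show Real.pi / 2 ∈ Set.Icc _ _ from ⟨by linarith [hu2.2], by linarith⟩)
      exact hcos y hy (by rw [show σ * y + s₀ = Real.pi / 2 from hyu]; simp)

end IsDirichletRuled

/-! ### The model surfaces -/

theorem hasDerivAt_arctanBranch {k : ℝ} (hk : 0 < k) (s : ℝ) :
    HasDerivAt (arctanBranch k) (k / (Real.cos s ^ 2 + k ^ 2 * Real.sin s ^ 2)) s := by
  have h1 := Real.sin_sq_add_cos_sq s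
  have hE : Real.cos s ^ 2 + k * Real.sin s ^ 2 ≠ 0 := by
    intro h0
    nlinarith [mul_nonneg hk.le (sq_nonneg (Real.sin s)), sq_nonneg (Real.cos s)]
  have hD : Real.cos s ^ 2 + k ^ 2 * Real.sin s ^ 2 ≠ 0 := by
    intro h0
    have h2 : 0 < k ^ 2 := by positivity
    nlinarith [mul_nonneg h2.le (sq_nonneg (Real.sin s)), sq_nonneg (Real.cos s)]
  have hsin := Real.hasDerivAt_sin s
  have hcos := Real.hasDerivAt_cos s
  have hq := (((hsin.const_mul (k - 1)).fun_mul hcos).fun_div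
    ((hcos.fun_pow 2).fun_add ((hsin.fun_pow 2).const_mul k)) hE).arctan
  refine ((hasDerivAt_id s).fun_add hq).congr_deriv ?_
  set c := Real.cos s
  set S := Real.sin s
  have hsum : (c ^ 2 + k * S ^ 2) ^ 2 + ((k - 1) * S * c) ^ 2 = c ^ 2 + k ^ 2 * S ^ 2 := by
    linear_combination (c ^ 2 + k ^ 2 * S ^ 2) * h1
  have hden : 1 + ((k - 1) * S * c / (c ^ 2 + k * S ^ 2)) ^ 2
      = (c ^ 2 + k ^ 2 * S ^ 2) / (c ^ 2 + k * S ^ 2) ^ 2 := by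
    rw [← hsum]
    field_simp
  rw [hden]
  field_simp
  simp
  linear_combination ((k - 1) * (c ^ 2 - k * S ^ 2) + k) * h1

theorem horizontal_or_vertical_or_oblique {g m : ℝ} (hg : 0 ≤ g) (hm : 0 ≤ m)
    (hgm : g ^ 2 + m ^ 2 = 1) : (g = 0 ∧ m = 1) ∨ (g = 1 ∧ m = 0) ∨ (0 < g ∧ m ∈ Set.Ioo 0 1) := by
  rcases hg.eq_or_lt with rfl | hg'
  · exact Or.inl ⟨rfl, by nlinarith⟩
  rcases hm.eq_or_lt with rfl | hm'
  · exact Or.inr (Or.inl ⟨by nlinarith, rfl⟩)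
  exact Or.inr (Or.inr ⟨hg', hm', by nlinarith⟩)

theorem greatCircle_one_zero : greatCircle 1 0 = horizontalEquator := by
  ext u i
  fin_cases i <;> simp [greatCircle, horizontalEquator]

theorem greatCircle_zero_one : greatCircle 0 1 = verticalEquator := by
  ext u i
  fin_cases i <;> simp [greatCircle, verticalEquator]

theorem greatCircle_eq_obliqueCircle {g m : ℝ} (hg : 0 ≤ g) (hgm : g ^ 2 + m ^ 2 = 1) :
    greatCircle g m = obliqueCircle m := by
  have : √(1 - m ^ 2) = g := by
    rw [← hgm, add_sub_cancel_right, Real.sqrt_sq hg]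
  ext u i
  fin_cases i <;> simp [greatCircle, obliqueCircle, this]

section oblique

variable {g m : ℝ}

theorem hasDerivAt_obliqueB (hg : 0 < g) (hgm : g ^ 2 + m ^ 2 = 1) (q u : ℝ) :
    HasDerivAt (obliqueB q m) (q / (m ^ 2 * Real.cos u ^ 2 + g ^ 2)) u := by
  have hs : √(1 - m ^ 2) = g := by rw [← hgm, add_sub_cancel_right, Real.sqrt_sq hg.le]
  have h := (hasDerivAt_arctanBranch hg u).const_mul (q / g)
  have hfun : obliqueB q m = fun u => q / g * arctanBranch g u := by
    funext u
    rw [obliqueB, hs]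
  rw [hfun]
  refine h.congr_deriv ?_
  have hD : Real.cos u ^ 2 + g ^ 2 * Real.sin u ^ 2 = m ^ 2 * Real.cos u ^ 2 + g ^ 2 := by
    linear_combination g ^ 2 * Real.sin_sq_add_cos_sq u - Real.cos u ^ 2 * hgm
  rw [hD]
  field_simp

/-- The derivative of `obliqueA 0 0 q m`, where `g = √(1 - m²)`. -/
def obliqueA' (g m q u : ℝ) : ℝ :=
  q * m / g ^ 2 * (Real.sin u * (Real.pi / 2 - arctanBranch g u)
      + Real.cos u * (g / (Real.cos u ^ 2 + g ^ 2 * Real.sin u ^ 2)))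
    + q / (m * g) * Real.cos u

theorem hasDerivAt_obliqueA (hg : 0 < g) (hgm : g ^ 2 + m ^ 2 = 1) (q u : ℝ) :
    HasDerivAt (obliqueA 0 0 q m) (obliqueA' g m q u) u := by
  have hs : √(1 - m ^ 2) = g := by rw [← hgm, add_sub_cancel_right, Real.sqrt_sq hg.le]
  have hs2 : 1 - m ^ 2 = g ^ 2 := by linarith
  have hfun : obliqueA 0 0 q m = fun u => q / (m * g) * Real.sin u
      - q * m / g ^ 2 * (Real.cos u * (Real.pi / 2 - arctanBranch g u)) := by
    funext u
    rw [obliqueA, hs, hs2]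
    ring
  rw [hfun]
  refine (((Real.hasDerivAt_sin u).const_mul (q / (m * g))).fun_sub
    (((Real.hasDerivAt_cos u).fun_mul
      ((hasDerivAt_arctanBranch hg u).const_sub (Real.pi / 2))).const_mul
        (q * m / g ^ 2))).congr_deriv ?_
  rw [obliqueA']
  ring

theorem hasDerivAt_obliqueA' (hg : 0 < g) (hm : m ≠ 0) (hgm : g ^ 2 + m ^ 2 = 1) (q u : ℝ) :
    HasDerivAt (obliqueA' g m q)
      (-2 * q * g * m * Real.sin u / (m ^ 2 * Real.cos u ^ 2 + g ^ 2) ^ 2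
        - obliqueA 0 0 q m u) u := by
  have hs : √(1 - m ^ 2) = g := by rw [← hgm, add_sub_cancel_right, Real.sqrt_sq hg.le]
  have hs2 : 1 - m ^ 2 = g ^ 2 := by linarith
  have hD : Real.cos u ^ 2 + g ^ 2 * Real.sin u ^ 2 = m ^ 2 * Real.cos u ^ 2 + g ^ 2 := by
    linear_combination g ^ 2 * Real.sin_sq_add_cos_sq u - Real.cos u ^ 2 * hgm
  have hD0 : m ^ 2 * Real.cos u ^ 2 + g ^ 2 ≠ 0 := by positivity
  have hsin := Real.hasDerivAt_sin u
  have hcos := Real.hasDerivAt_cos u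
  have hA := (hasDerivAt_arctanBranch hg u).const_sub (Real.pi / 2)
  have hfrac := (hasDerivAt_const u g).fun_div
    ((hcos.fun_pow 2).fun_add ((hsin.fun_pow 2).const_mul (g ^ 2))) (hD ▸ hD0)
  refine ((((hsin.fun_mul hA).fun_add (hcos.fun_mul hfrac)).const_mul (q * m / g ^ 2)).fun_add
    (hcos.const_mul (q / (m * g)))).congr_deriv ?_
  rw [obliqueA, hs, hs2, hD]
  set S := Real.sin u
  set c := Real.cos u
  have hm2 : m ^ 2 = 1 - g ^ 2 := by linarith
  have hS2 : S ^ 2 + c ^ 2 = 1 := Real.sin_sq_add_cos_sq u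
  field_simp
  simp
  linear_combination (-4 * q * m ^ 2 * g * S * c ^ 2) * hgm

end oblique

theorem hasDerivAt_inv_cos {u : ℝ} (hu : Real.cos u ≠ 0) (K : ℝ) :
    HasDerivAt (fun u => K / Real.cos u) (K * Real.sin u / Real.cos u ^ 2) u := by
  refine ((hasDerivAt_const u K).fun_div (Real.hasDerivAt_cos u) hu).congr_deriv ?_
  ring

theorem hasDerivAt_sin_div_cos_sq {u : ℝ} (hu : Real.cos u ≠ 0) (K : ℝ) :
    HasDerivAt (fun u => K * Real.sin u / Real.cos u ^ 2)
      (2 * K / Real.cos u ^ 3 - K / Real.cos u) u := by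
  refine (((Real.hasDerivAt_sin u).const_mul K).fun_div ((Real.hasDerivAt_cos u).fun_pow 2)
    (pow_ne_zero 2 hu)).congr_deriv ?_
  field_simp
  simp
  linear_combination 2 * K * Real.cos u * Real.sin_sq_add_cos_sq u

namespace IsDirichletRuled

variable {I : Set ℝ} {α β : ℝ → E3} {a b : ℝ → ℝ} {Λ : ℝ}

/-- The equations for `a` and `b` along a great circle. -/
theorem ode_greatCircle (h : IsDirichletRuled I α β a b Λ) {θ σ s₀ g m q : ℝ}
    (hσ : σ = 1 ∨ σ = -1) (hR : ∀ s ∈ I, rotZ θ (β s) = greatCircle g m (σ * s + s₀))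
    (hC : ∀ s ∈ I, deriv β s 2 = σ * (m * Real.cos (σ * s + s₀)))
    (hG : ∀ s ∈ I, binormal β s 2 = σ * g) (hq : ∀ s ∈ I, flux β a b s = q) (hq0 : q ≠ 0)
    {s : ℝ} (hs : s ∈ I) :
    m ^ 2 * Real.cos (σ * s + s₀) ^ 2 + g ^ 2 ≠ 0 ∧
    deriv b s = q / (m ^ 2 * Real.cos (σ * s + s₀) ^ 2 + g ^ 2) ∧
    σ * (deriv (deriv a) s + a s)
      = -2 * q * g * m * Real.sin (σ * s + s₀)
          / (m ^ 2 * Real.cos (σ * s + s₀) ^ 2 + g ^ 2) ^ 2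
        + Λ / 2 * q ^ 2 * (m * Real.cos (σ * s + s₀)) ^ 3
          / (m ^ 2 * Real.cos (σ * s + s₀) ^ 2 + g ^ 2) ^ 3 := by
  have hσ2 : σ * σ = 1 := by rcases hσ with rfl | rfl <;> norm_num
  obtain ⟨-, -, hD, -, heq⟩ := h.equations hs (h.nondegenerate hs)
  have hqs := hq s hs
  have hB : β s 2 = m * Real.sin (σ * s + s₀) := by
    rw [← rotZ_two θ, hR s hs]
    simp [greatCircle]
  rw [flux, h.pitch_eq hs] at hqs
  rw [h.pitch_eq hs, h.deriv_offset hs] at heq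
  rw [hC s hs, hG s hs] at hD hqs heq
  rw [hB] at heq
  set D := m ^ 2 * Real.cos (σ * s + s₀) ^ 2 + g ^ 2 with hD_def
  have hDD : (σ * (m * Real.cos (σ * s + s₀))) ^ 2 + (σ * g) ^ 2 = D := by
    linear_combination (m ^ 2 * Real.cos (σ * s + s₀) ^ 2 + g ^ 2) * hσ2
  rw [hDD] at hD hqs heq
  have hb : deriv b s = q / D := by
    rw [← hqs]
    field_simp
  refine ⟨hD, hb, ?_⟩
  rw [hb] at heq
  field_simp at heq ⊢
  rcases hσ with rfl | rfl <;> linarith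

theorem vertical (h : IsDirichletRuled I α β a b Λ) {θ σ s₀ q : ℝ}
    (hσ : σ = 1 ∨ σ = -1) (hR : ∀ s ∈ I, rotZ θ (β s) = greatCircle 0 1 (σ * s + s₀))
    (hC : ∀ s ∈ I, deriv β s 2 = σ * (1 * Real.cos (σ * s + s₀)))
    (hG : ∀ s ∈ I, binormal β s 2 = σ * 0) (hq : ∀ s ∈ I, flux β a b s = q) (hq0 : q ≠ 0)
    {am am' am₂ : ℝ → ℝ}
    (ham : ∀ u, Real.cos u ≠ 0 → HasDerivAt am (am' u) u)
    (ham' : ∀ u, Real.cos u ≠ 0 → HasDerivAt am' (am₂ u) u)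
    (hsum : ∀ u, Real.cos u ≠ 0 → am₂ u + am u = Λ * q ^ 2 / 2 / Real.cos u ^ 3) :
    SameUpToMotion I α β ((fun s => σ * s + s₀) '' I) verticalEquator am
      (fun u => q * Real.tan u) := by
  have hode := fun s hs => h.ode_greatCircle hσ hR hC hG hq hq0 (s := s) hs
  have hcos : ∀ s ∈ I, Real.cos (σ * s + s₀) ≠ 0 := by
    intro s hs h0
    have := (hode s hs).1
    simp [h0] at this
  refine h.sameUpToMotion hσ (greatCircle_zero_one ▸ differentiable_greatCircle 0 1)
    (greatCircle_zero_one ▸ hR) (fun s hs => ham _ (hcos s hs)) (fun s hs => ham' _ (hcos s hs))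
    (fun s hs => ?_) (fun s hs => ?_)
  · rw [hsum _ (hcos s hs), (hode s hs).2.2]
    have := hcos s hs
    field_simp
    ring
  · refine ((Real.hasDerivAt_tan (hcos s hs)).const_mul q).congr_deriv ?_
    rw [(hode s hs).2.1]
    ring

end IsDirichletRuled

end RuledDirichlet

end

open RuledDirichlet
theorem theorem1p1 (I : Set ℝ) (hIo : IsOpen I) (hIc : I.OrdConnected)
    (α β : ℝ → E3) (a b : ℝ → ℝ)
    (ha : ContDiffOn ℝ ∞ a I) (hb : ContDiffOn ℝ ∞ b I) (hβ : ContDiffOn ℝ ∞ β I)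
    (hβ₁ : ∀ s ∈ I, ‖β s‖ = 1) (hβ₂ : ∀ s ∈ I, ‖deriv β s‖ = 1)
    (hα : ∀ s ∈ I, α s = a s • deriv β s + b s • cross (β s) (deriv β s))
    (hν : ∃ s ∈ I, ∃ t : ℝ, unitNormal (ruled α β) s t 2 ≠ 0)
    (Λ : ℝ)
    (hΛ : ∀ s ∈ I, ∀ t : ℝ, unitNormal (ruled α β) s t 2 ≠ 0 →
      anisotropicMeanCurvature dirichletDensity (ruled α β) s t = Λ) :
    InGreatCircle I β ∧
    (Λ = 0 →
      IsPlanar I (ruled α β) ∨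
      (∃ (J : Set ℝ) (c₁ b₁ : ℝ), c₁ ≠ 0 ∧ b₁ ≠ 0 ∧
        SameUpToMotion I α β J horizontalEquator
          (fun s => c₁ * Real.cos s) (fun s => b₁ * s)) ∨
      (∃ (J : Set ℝ) (c₁ c₂ b₁ : ℝ), J ⊆ Set.Ioo (-(Real.pi / 2)) (Real.pi / 2) ∧
        c₁ ≠ 0 ∧ b₁ ≠ 0 ∧
        SameUpToMotion I α β J verticalEquator
          (fun s => c₁ * Real.cos (s + c₂)) (fun s => b₁ * Real.tan s)) ∨
      (∃ (J : Set ℝ) (c₁ c₂ b₁ m : ℝ), b₁ ≠ 0 ∧ m ∈ Set.Ioo (0 : ℝ) 1 ∧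
        SameUpToMotion I α β J (obliqueCircle m)
          (obliqueA c₁ c₂ b₁ m) (obliqueB b₁ m))) ∧
    (Λ ≠ 0 →
      ∃ (J : Set ℝ) (c₁ c₂ b₁ : ℝ), J ⊆ Set.Ioo (-(Real.pi / 2)) (Real.pi / 2) ∧ b₁ ≠ 0 ∧
        SameUpToMotion I α β J verticalEquator
          (fun s => c₁ * Real.cos s + c₂ * Real.sin s
            - Λ * b₁ ^ 2 * Real.cos (2 * s) / (4 * Real.cos s))
          (fun s => b₁ * Real.tan s)) := by
  obtain h : IsDirichletRuled I α β a b Λ :=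
    ⟨⟨hIo, hβ, hβ₁, hβ₂⟩, hIc, ha, hb, hα, hν, hΛ⟩
  refine ⟨h.inGreatCircle, ?_⟩
  obtain ⟨θ, σ, s₀, g, m, hσ, hg, hm, hgm, hR, hC, hG, hJ⟩ := h.exists_greatCircle
  obtain ⟨s₁, hs₁, -⟩ := h.exists_graph
  have hq : ∀ s ∈ I, flux β a b s = flux β a b s₁ :=
    fun s hs => h.flux_eq hs hs₁
  set q := flux β a b s₁
  have hJ' : g = 0 → (fun s => σ * s + s₀) '' I ⊆ Set.Ioo (-(Real.pi / 2)) (Real.pi / 2) := by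
    rintro hg0 - ⟨s, hs, rfl⟩
    exact hJ hg0 s hs
  constructor
  · rintro rfl
    by_cases hq0 : q = 0
    · exact Or.inl (h.isPlanar fun s hs => (hq s hs).trans hq0)
    right
    rcases horizontal_or_vertical_or_oblique hg hm hgm with
      ⟨rfl, rfl⟩ | ⟨rfl, rfl⟩ | ⟨hg', hm'⟩
    · refine Or.inr (Or.inl ⟨(fun s => σ * s + s₀) '' I, 1, 0, q, hJ' rfl, one_ne_zero, hq0, ?_⟩)
      refine h.vertical hσ hR hC hG hq hq0 (am' := fun u => -Real.sin u)
        (am₂ := fun u => -Real.cos u) (fun u _ => ?_) (fun u _ => ?_) (fun u _ => ?_)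
      · simpa using Real.hasDerivAt_cos u
      · exact (Real.hasDerivAt_sin u).fun_neg
      · simp
    -- The amplitude of `a` can be any constant, since a horizontal translation changes it.
    · refine Or.inl ⟨(fun s => σ * s + s₀) '' I, 1, q, one_ne_zero, hq0, ?_⟩
      have hode := fun s hs => h.ode_greatCircle hσ hR hC hG hq hq0 (s := s) hs
      refine h.sameUpToMotion hσ (greatCircle_one_zero ▸ differentiable_greatCircle 1 0)
        (greatCircle_one_zero ▸ hR) (am' := fun u => -Real.sin u) (am₂ := fun u => -Real.cos u)
        (fun s hs => ?_) (fun s hs => ?_) (fun s hs => ?_) (fun s hs => ?_)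
      · simpa using Real.hasDerivAt_cos (σ * s + s₀)
      · exact (Real.hasDerivAt_sin _).fun_neg
      · rw [(hode s hs).2.2]
        simp
      · simpa [(hode s hs).2.1] using (hasDerivAt_id (σ * s + s₀)).const_mul q
    · refine Or.inr (Or.inr ⟨(fun s => σ * s + s₀) '' I, 0, 0, q, m, hq0, hm', ?_⟩)
      have hode := fun s hs => h.ode_greatCircle hσ hR hC hG hq hq0 (s := s) hs
      refine h.sameUpToMotion hσ
        (greatCircle_eq_obliqueCircle hg hgm ▸ differentiable_greatCircle g m)
        (greatCircle_eq_obliqueCircle hg hgm ▸ hR)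
        (am₂ := fun u => -2 * q * g * m * Real.sin u / (m ^ 2 * Real.cos u ^ 2 + g ^ 2) ^ 2
          - obliqueA 0 0 q m u)
        (fun s hs => hasDerivAt_obliqueA hg' hgm q _)
        (fun s hs => hasDerivAt_obliqueA' hg' hm'.1.ne' hgm q _)
        (fun s hs => ?_) (fun s hs => ?_)
      · rw [(hode s hs).2.2]
        ring
      · rw [(hode s hs).2.1]
        exact hasDerivAt_obliqueB hg' hgm q _
  · intro hΛ0
    have hne := h.nondegenerate hs₁
    have hG0 : binormal β s₁ 2 = 0 := (mul_eq_zero.1 (h.equations hs₁ hne).1).resolve_left hΛ0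
    have hσ0 : σ ≠ 0 := by rcases hσ with rfl | rfl <;> norm_num
    have hg0 : g = 0 := (mul_eq_zero.1 ((hG s₁ hs₁).symm.trans hG0)).resolve_left hσ0
    subst hg0
    have hm1 : m = 1 := by nlinarith
    subst hm1
    have hq0 : q ≠ 0 := mul_ne_zero
      (left_ne_zero_of_mul (hne.resolve_left (not_not.2 hG0))) (h.equations hs₁ hne).2.2.1
    refine ⟨(fun s => σ * s + s₀) '' I, Λ * q ^ 2 / 2, 0, q, hJ' rfl, hq0, ?_⟩
    -- With this coefficient of `cos`, and `cos 2s = 2 cos² s - 1`, only `1 / cos s` remains.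
    have hfun : (fun s => Λ * q ^ 2 / 2 * Real.cos s + 0 * Real.sin s
        - Λ * q ^ 2 * Real.cos (2 * s) / (4 * Real.cos s))
        = fun s => Λ * q ^ 2 / 4 / Real.cos s := by
      funext s
      rw [Real.cos_two_mul]
      by_cases hc : Real.cos s = 0
      · simp [hc]
      · field_simp
        ring
    rw [hfun]
    exact h.vertical hσ hR hC hG hq hq0 (fun u hu => hasDerivAt_inv_cos hu _)
      (fun u hu => hasDerivAt_sin_div_cos_sq hu _) (fun u hu => by ring)
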